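/- Let $O=(X,Z,A,Y)$ with covariates $X\in\mathcal X$, real-valued continuous instrument $Z$, binary exposure $A\in\{0,1\}$ and real outcome $Y$, and fix $\delta\in\mathbb R$. For a law $P$ of $O$ let $\Pi_P(\cdot\mid x)$ be the conditional law of $Z$ given $X=x$, $\alpha_\delta(x)=E_P(e^{\delta Z}\mid X=x)$, and let $Q_\delta(\cdot\mid x)$ be the exponentially tilted law $dQ_\delta(u\mid x)=e^{\delta u}\,d\Pi_P(u\mid x)/\alpha_\delta(x)$. Consider the functional $$\psi(\delta)=\psi(\delta;P)=\frac{\iint E_P(Y\mid Z=u,X=x)\,dQ_\delta(u\mid x)\,dP(x)-E_P(Y)}{\iint E_P(A\mid Z=u,X=x)\,dQ_\delta(u\mid x)\,dP(x)-E_P(A)}$$ on the nonparametric model $\mathcal M$ of all laws $P$ of $O$ such that $Z$ has a conditional Lebesgue density given $X$, $\alpha_\delta(X)<\infty$ almost surely, $Y$ and $Y e^{\delta Z}/\alpha_\delta(X)$ are integrable, and the instrument is relevant, i.e. the denominator of $\psi(\delta;P)$ is nonzero. A regular submodel through $P\in\mathcal M$ with score $s\in L^2(P)$ is a family $(P_t)$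 with $P_0=P$ and, for all $t$ near $0$, $P_t\in\mathcal M$ and $C^{-1}\le dP_t/dP\le C$ for some constant $C$, which is differentiable in quadratic mean at $t=0$: $\int\{(\sqrt{dP_t/dP}-1)/t-s/2\}^2dP\to0$ as $t\to 0$. The tangent space at $P$ is the closed linear span in $L^2(P)$ of all scores. An efficient influence function of $\psi(\delta)$ at $P$ is a function $\varphi$ in the tangent space such that, for every regular submodel with score $s$, $t\mapsto\psi(\delta;P_t)$ is differentiable at $0$ with derivative $E_P(\varphi s)$. Theorem. For a random variable $T$ put $\gamma^T_\delta(X)=E_P(Te^{\delta Z}\mid X)/\alpha_\delta(X)$, $$\xi(T;\delta)=T\frac{e^{\delta Z}}{\alpha_\delta(X)}+\gamma^T_\delta(X)\Big(1-\frac{e^{\delta Z}}{\alpha_\delta(X)}\Big),\qquad \Theta(T;\delta,0)=\xi(T;\delta)-\xi(T;0).$$ Let $P\in\mathcal M$ be such that $Y$, $\xi(Y;\delta)$ and $\xi(A;\delta)$ have finite second moments under $P$. Then the tangent space of $\mathcal M$ at $P$ is the set of all mean-zero functions in $L^2(P)$, and the efficient influence function of $\psi(\delta)$ at $P$ exists,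 is unique up to $P$-almost sure equality, and is $$\varphi_\delta=\frac{\Theta(Y;\delta,0)-\psi(\delta)\,\Theta(A;\delta,0)}{E_P\{\gamma^A_\delta(X)-A\}}.$$ -/

import Mathlib

open MeasureTheory ProbabilityTheory Filter Topology

noncomputable section

namespace TiltedLATE

/-! ### Influence functions in a statistical model -/

section General

variable {Ω : Type*} [MeasurableSpace Ω]

/-- `t ↦ path t` is a regular one-dimensional submodel of the model `M` through `P` at `t = 0`,
with score `s`: near `t = 0` the law `path t` belongs to `M`, the likelihood ratio of `path t` and
`P` is bounded above and away from zero (uniformly in `t`), and the path is differentiable in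
quadratic mean at `t = 0` with score `s`, that is,
`∫ ((√(dP_t/dP) - 1) / t - s / 2) ^ 2 dP → 0` as `t → 0`, `t ≠ 0`. -/
structure IsRegularSubmodel (M : Set (ProbabilityMeasure Ω)) (P : ProbabilityMeasure Ω)
    (path : ℝ → ProbabilityMeasure Ω) (s : Ω → ℝ) : Prop where
  at_zero : path 0 = P
  mem_model : ∀ᶠ t in 𝓝 (0 : ℝ), path t ∈ M
  bounded_ratio : ∃ C : NNReal, ∀ᶠ t in 𝓝 (0 : ℝ),
    (path t : Measure Ω) ≤ C • (P : Measure Ω) ∧ (P : Measure Ω) ≤ C • (path t : Measure Ω)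
  score_memLp : MemLp s 2 (P : Measure Ω)
  quadratic_mean : Tendsto
    (fun t : ℝ => eLpNorm
      (fun o => (Real.sqrt ((path t : Measure Ω).rnDeriv (P : Measure Ω) o).toReal - 1) / t
        - s o / 2) 2 (P : Measure Ω))
    (𝓝[≠] 0) (𝓝 0)

/-- The set of all scores at `P` of regular submodels of `M`, as elements of `L²(P)`. -/
def tangentSet (M : Set (ProbabilityMeasure Ω)) (P : ProbabilityMeasure Ω) :
    Set (Lp ℝ 2 (P : Measure Ω)) :=
  {g | ∃ path : ℝ → ProbabilityMeasure Ω, IsRegularSubmodel M P path g}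

/-- The tangent space of `M` at `P`: the closed linear span in `L²(P)` of all scores. -/
def tangentSpace (M : Set (ProbabilityMeasure Ω)) (P : ProbabilityMeasure Ω) :
    Submodule ℝ (Lp ℝ 2 (P : Measure Ω)) :=
  (Submodule.span ℝ (tangentSet M P)).topologicalClosure

/-- `φ` is an efficient influence function (canonical gradient) at `P` of the functional
`Ψ` on the model `M`: `φ` lies in `L²(P)`, it belongs to the tangent space, and along every regular
submodel with score `s` the functional is differentiable with derivative `E_P(φ s)`. -/
structure IsEfficientInfluenceFunction (M : Set (ProbabilityMeasure Ω))
    (Ψ : ProbabilityMeasure Ω → ℝ) (P : ProbabilityMeasure Ω) (φ : Ω → ℝ) : Prop where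
  memLp : MemLp φ 2 (P : Measure Ω)
  mem_tangentSpace : memLp.toLp φ ∈ tangentSpace M P
  hasDerivAt : ∀ (path : ℝ → ProbabilityMeasure Ω) (s : Ω → ℝ), IsRegularSubmodel M P path s →
    HasDerivAt (fun t => Ψ (path t)) (∫ o, φ o * s o ∂(P : Measure Ω)) 0

/-- The conditional expectation `E_P(U ∣ V = v)` of a real random variable `U`, computed from the
regular conditional distribution of `U` given `V`. -/
def condMean {β : Type*} [MeasurableSpace β] (P : ProbabilityMeasure Ω) (U : Ω → ℝ) (V : Ω → β)
    (v : β) : ℝ :=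
  ∫ u, u ∂(condDistrib U V (P : Measure Ω) v)

end General

/-! ### Instrumental variable data and the tilted functional -/

/-- One observation `(X, Z, A, Y)`: covariates, real instrument, binary exposure, real outcome. -/
abbrev Obs (𝒳 : Type*) : Type _ := 𝒳 × ℝ × Bool × ℝ

variable {𝒳 : Type*}

/-- The covariates `X`. -/
def covX (o : Obs 𝒳) : 𝒳 := o.1

/-- The instrument `Z`. -/
def instrZ (o : Obs 𝒳) : ℝ := o.2.1

/-- The exposure `A`, as a real number in `{0, 1}`. -/
def expoA (o : Obs 𝒳) : ℝ := if o.2.2.1 then 1 else 0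

/-- The outcome `Y`. -/
def outcomeY (o : Obs 𝒳) : ℝ := o.2.2.2

variable [MeasurableSpace 𝒳]

/-- The tilted conditional distribution `Q_δ(· ∣ X = x)` of the instrument:
`dQ_δ(u ∣ x) = e^{δ u} dΠ(u ∣ x) / ∫ e^{δ v} dΠ(v ∣ x)`, with `Π(· ∣ x)` the conditional
distribution of `Z` given `X = x` under `P`. -/
def tiltedQ (δ : ℝ) (P : ProbabilityMeasure (Obs 𝒳)) (x : 𝒳) : Measure ℝ :=
  (condDistrib instrZ covX (P : Measure (Obs 𝒳)) x).tilted (fun u => δ * u)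

/-- `∬ E_P(T ∣ Z = u, X = x) dQ_δ(u ∣ x) dP(x)`. -/
def tiltedMean (δ : ℝ) (P : ProbabilityMeasure (Obs 𝒳)) (T : Obs 𝒳 → ℝ) : ℝ :=
  ∫ x, ∫ u, condMean P T (fun o => (covX o, instrZ o)) (x, u) ∂(tiltedQ δ P x)
    ∂((P : Measure (Obs 𝒳)).map covX)

/-- The functional `ψ(δ)` of the law of the observed data. -/
def psi (δ : ℝ) (P : ProbabilityMeasure (Obs 𝒳)) : ℝ :=
  (tiltedMean δ P outcomeY - ∫ o, outcomeY o ∂(P : Measure (Obs 𝒳))) /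
    (tiltedMean δ P expoA - ∫ o, expoA o ∂(P : Measure (Obs 𝒳)))

/-- `α_δ(x) = E_P(e^{δ Z} ∣ X = x)`. -/
def alpha (δ : ℝ) (P : ProbabilityMeasure (Obs 𝒳)) (x : 𝒳) : ℝ :=
  condMean P (fun o => Real.exp (δ * instrZ o)) covX x

/-- `γ^T_δ(x) = E_P(T e^{δ Z} ∣ X = x) / α_δ(x)`. -/
def gamma (δ : ℝ) (P : ProbabilityMeasure (Obs 𝒳)) (T : Obs 𝒳 → ℝ) (x : 𝒳) : ℝ :=
  condMean P (fun o => T o * Real.exp (δ * instrZ o)) covX x / alpha δ P x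

/-- `ξ(T; δ) = T e^{δ Z} / α_δ(X) + γ^T_δ(X) (1 - e^{δ Z} / α_δ(X))`. -/
def xi (δ : ℝ) (P : ProbabilityMeasure (Obs 𝒳)) (T : Obs 𝒳 → ℝ) (o : Obs 𝒳) : ℝ :=
  T o * (Real.exp (δ * instrZ o) / alpha δ P (covX o)) +
    gamma δ P T (covX o) * (1 - Real.exp (δ * instrZ o) / alpha δ P (covX o))

/-- `Θ(T; δ, 0) = ξ(T; δ) - ξ(T; 0)`. -/
def Theta (δ : ℝ) (P : ProbabilityMeasure (Obs 𝒳)) (T : Obs 𝒳 → ℝ) (o : Obs 𝒳) : ℝ :=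
  xi δ P T o - xi 0 P T o

/-- `φ_δ = (Θ(Y; δ, 0) - ψ(δ) Θ(A; δ, 0)) / E_P(γ^A_δ(X) - A)`. -/
def phi (δ : ℝ) (P : ProbabilityMeasure (Obs 𝒳)) (o : Obs 𝒳) : ℝ :=
  (Theta δ P outcomeY o - psi δ P * Theta δ P expoA o) /
    ∫ o', (gamma δ P expoA (covX o') - expoA o') ∂(P : Measure (Obs 𝒳))

/-- The nonparametric model: all laws of `(X, Z, A, Y)` for which `Z` has a conditional Lebesgue
density given `X`, the quantities entering `ψ(δ)` are well defined, and the instrument is relevant.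
No other restriction is made. -/
structure InModel (δ : ℝ) (P : ProbabilityMeasure (Obs 𝒳)) : Prop where
  /-- `Z` is a continuous instrument: it has a conditional density given `X`. -/
  continuous_instrument : ∀ᵐ x ∂((P : Measure (Obs 𝒳)).map covX),
    condDistrib instrZ covX (P : Measure (Obs 𝒳)) x ≪ volume
  /-- `E(e^{δ Z} ∣ X)` is finite almost surely. -/
  tilt_finite : ∀ᵐ x ∂((P : Measure (Obs 𝒳)).map covX),
    Integrable (fun u => Real.exp (δ * u)) (condDistrib instrZ covX (P : Measure (Obs 𝒳)) x)
  /-- `E(Y)` exists. -/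
  integrable_outcome : Integrable outcomeY (P : Measure (Obs 𝒳))
  /-- The mean of `Y` under the tilted instrument distribution exists. -/
  integrable_tilted_outcome :
    Integrable (fun o => outcomeY o * (Real.exp (δ * instrZ o) / alpha δ P (covX o)))
      (P : Measure (Obs 𝒳))
  /-- Relevance: `∬ E(A ∣ Z = u, X = x) dQ_δ(u ∣ x) dP(x) ≠ E(A)`. -/
  relevance : tiltedMean δ P expoA ≠ ∫ o, expoA o ∂(P : Measure (Obs 𝒳))

/-- The nonparametric model, as a set of laws. -/
def nonparametricModel (𝒳 : Type*) [MeasurableSpace 𝒳] (δ : ℝ) :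
    Set (ProbabilityMeasure (Obs 𝒳)) :=
  {P | InModel δ P}

end TiltedLATE

end

/-!
The functional is a ratio of two contrasts `E(T e^{δ Z} / α_δ(X)) - E(T)`, for `T = Y` and `T = A`,
and everything rests on the pathwise expansion of the weighted mean. Write `w = e^{δ Z} / α_δ(X)`
and `D = (T - γ^T_δ(X)) w`, so that `ξ(T; δ) = D + γ^T_δ(X)`, `E_P(w ∣ X) = 1` and `E_P(D ∣ X) = 0`.
If `P'` has likelihood ratio `r = dP'/dP` bounded above and below, and `a = α_δ(X; P) / α_δ(X; P')`,
then the weight of `P'` is `w a`, and the two centring identities under `P` and `P'` give the exact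
formula (`BoundedRatio.tiltedMean_eq`)

  `tiltedMean δ P' T = E_{P'} ξ(T; δ) + E_P ((r - 1) (a - 1) D)`.

Along a path differentiable in quadratic mean, `(r_t - 1) / t` converges in `L²(P)` to the score
(`hasL2Score_of_sqrt`). The ratio `a_t` is uniformly bounded, and `a_t → 1` in `L¹(P)`, because
`E_P |a_t - 1|` is at most a constant times `E_P (|r_t - 1| |w - 1|)`
(`BoundedRatio.integral_abs_alphaRatio_sub_one_le`); hence `(a_t - 1) D → 0` in `L²(P)` and the
remainder is `o(t)`. So `ξ(T; δ)` is a gradient of the tilted mean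
(`IsDifferentiablePath.hasDerivAt_tiltedMean`), `Θ(T; δ, 0)` is one of the contrast, and the
quotient rule yields `φ_δ`.

For the tangent space, all conditions of the model except relevance are inherited by laws with
bounded likelihood ratio (`BoundedRatio.inModel`). Relevance persists near `t = 0` because the
contrast for `A` is differentiable, hence continuous, along the path. Thus every bounded mean-zero
`g` is the score of `(1 + t g) dP` (`isRegularSubmodel_perturbation`), and centred simple functions
are dense among mean-zero functions. Uniqueness follows since the difference of two gradients in
the tangent space is orthogonal to the tangent space.
-/

noncomputable section

namespace TiltedLATE

/-! ### Mean-square estimates -/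

section MeanSquare

variable {Ω ι : Type*} [MeasurableSpace Ω] {μ : Measure Ω}

/-- Dominated convergence for a uniformly bounded family that tends to zero only in `L¹`: the
weight `g` is truncated at a high level. -/
theorem tendsto_integral_abs_mul_of_bounded {l : Filter ι} {g : Ω → ℝ} {b : ι → Ω → ℝ} {K : ℝ}
    (hg : Integrable g μ) (hb : ∀ᶠ i in l, Integrable (b i) μ)
    (hK : ∀ᶠ i in l, ∀ᵐ o ∂μ, |b i o| ≤ K)
    (hlim : Tendsto (fun i => ∫ o, |b i o| ∂μ) l (𝓝 0)) :
    Tendsto (fun i => ∫ o, |g o| * |b i o| ∂μ) l (𝓝 0) := by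
  have htail : Tendsto (fun n : ℕ => ∫ o, (|g o| - min |g o| n) ∂μ) atTop (𝓝 0) := by
    have h := tendsto_integral_filter_of_dominated_convergence (μ := μ) (l := atTop)
      (F := fun (n : ℕ) o => |g o| - min |g o| n) (f := fun _ => (0 : ℝ)) (fun o => |g o|)
      (Eventually.of_forall fun n => by
        have := hg.aestronglyMeasurable.norm
        exact this.sub (this.inf aestronglyMeasurable_const))
      (Eventually.of_forall fun n => Eventually.of_forall fun o => by
        have h0 : (0 : ℝ) ≤ min |g o| n := le_min (abs_nonneg _) (Nat.cast_nonneg _)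
        have h1 : min |g o| (n : ℝ) ≤ |g o| := min_le_left _ _
        rw [Real.norm_eq_abs, abs_of_nonneg (by linarith)]
        linarith)
      hg.abs
      (Eventually.of_forall fun o => by
        obtain ⟨N, hN⟩ := exists_nat_ge |g o|
        refine tendsto_const_nhds.congr' ?_
        filter_upwards [eventually_ge_atTop N] with n hn
        rw [min_eq_left (hN.trans (by exact_mod_cast hn)), sub_self])
    simpa using h
  have hK0 : (0 : ℝ) ≤ max K 0 := le_max_right _ _
  rw [Metric.tendsto_nhds]
  intro ε hε
  obtain ⟨n, hn⟩ : ∃ n : ℕ, max K 0 * ∫ o, (|g o| - min |g o| n) ∂μ < ε / 2 := by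
    have h := (htail.const_mul (max K 0))
    rw [mul_zero] at h
    exact (h.eventually (gt_mem_nhds (half_pos hε))).exists
  have hsmall : ∀ᶠ i in l, (n : ℝ) * ∫ o, |b i o| ∂μ < ε / 2 := by
    have h := hlim.const_mul (n : ℝ)
    rw [mul_zero] at h
    exact h.eventually (gt_mem_nhds (half_pos hε))
  filter_upwards [hb, hK, hsmall] with i hbi hKi hi
  have htr : Integrable (fun o => |g o| - min |g o| n) μ := by
    refine hg.abs.mono' ?_ (Eventually.of_forall fun o => ?_)
    · have := hg.aestronglyMeasurable.norm
      exact this.sub (this.inf aestronglyMeasurable_const)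
    · have h0 : (0 : ℝ) ≤ min |g o| n := le_min (abs_nonneg _) (Nat.cast_nonneg _)
      have h1 : min |g o| (n : ℝ) ≤ |g o| := min_le_left _ _
      rw [Real.norm_eq_abs, abs_of_nonneg (by linarith)]
      linarith
  have hle : ∫ o, |g o| * |b i o| ∂μ ≤
      ∫ o, (max K 0 * (|g o| - min |g o| n) + n * |b i o|) ∂μ := by
    refine integral_mono_of_nonneg (Eventually.of_forall fun o => by positivity)
      ((htr.const_mul _).add (hbi.abs.const_mul _)) ?_
    filter_upwards [hKi] with o ho
    have h1 : min |g o| (n : ℝ) ≤ |g o| := min_le_left _ _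
    have h2 : min |g o| (n : ℝ) ≤ n := min_le_right _ _
    have h3 : |b i o| ≤ max K 0 := ho.trans (le_max_left _ _)
    have h4 := mul_le_mul_of_nonneg_left h3 (sub_nonneg.2 h1)
    have h5 := mul_le_mul_of_nonneg_right h2 (abs_nonneg (b i o))
    calc |g o| * |b i o| = (|g o| - min |g o| n) * |b i o| + min |g o| n * |b i o| := by ring
      _ ≤ _ := by linarith
  rw [integral_add (htr.const_mul _) (hbi.abs.const_mul _), integral_const_mul,
    integral_const_mul] at hle
  rw [Real.dist_eq, sub_zero, abs_of_nonneg (integral_nonneg fun o => by positivity)]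
  linarith

theorem abs_integral_mul_le_sqrt {f g : Ω → ℝ} (hf : MemLp f 2 μ) (hg : MemLp g 2 μ) :
    |∫ o, f o * g o ∂μ| ≤ √(∫ o, f o ^ 2 ∂μ) * √(∫ o, g o ^ 2 ∂μ) := by
  have h := integral_mul_le_Lp_mul_Lq_of_nonneg (μ := μ) (p := 2) (q := 2)
    (f := fun o => |f o|) (g := fun o => |g o|) (by constructor <;> norm_num)
    (Eventually.of_forall fun o => abs_nonneg _) (Eventually.of_forall fun o => abs_nonneg _)
    (by simpa using hf.norm) (by simpa using hg.norm)
  simp only [Real.rpow_two, sq_abs, ← Real.sqrt_eq_rpow] at h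
  refine le_trans ?_ h
  refine (abs_integral_le_integral_abs).trans (le_of_eq ?_)
  simp [abs_mul]

theorem integral_sq_eq_eLpNorm_sq {f : Ω → ℝ} (hf : AEStronglyMeasurable f μ) :
    ∫ o, f o ^ 2 ∂μ = ((eLpNorm f 2 μ) ^ 2).toReal := by
  have h : eLpNorm f 2 μ ^ 2 = ∫⁻ o, ENNReal.ofReal (f o ^ 2) ∂μ := by
    have h := eLpNorm_nnreal_pow_eq_lintegral (f := f) (μ := μ) (p := 2) (by norm_num)
    simp only [NNReal.coe_ofNat, ENNReal.coe_ofNat, ENNReal.rpow_ofNat] at h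
    rw [h]
    refine lintegral_congr fun o => ?_
    rw [← ofReal_norm, ← ENNReal.ofReal_pow (norm_nonneg _), Real.norm_eq_abs, sq_abs]
  rw [h, integral_eq_lintegral_of_nonneg_ae (Eventually.of_forall fun o => sq_nonneg _)
    (hf.pow 2)]

end MeanSquare

/-! ### Differentiability of the likelihood ratio -/

section LikelihoodRatio

variable {Ω : Type*} [MeasurableSpace Ω] {μ : Measure Ω} [IsFiniteMeasure μ]

/-- `r t`, `t` near `0`, is a family of likelihood ratios bounded by `C` whose difference quotient
at `t = 0` converges to `s` in `L²`; this is what quadratic mean differentiability gives for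
densities bounded above. -/
structure HasL2Score (μ : Measure Ω) (r : ℝ → Ω → ℝ) (C : ℝ) (s : Ω → ℝ) : Prop where
  measurable : ∀ t, Measurable (r t)
  bounded : ∀ᶠ t in 𝓝[≠] (0 : ℝ), ∀ᵐ o ∂μ, |r t o| ≤ C
  score_memLp : MemLp s 2 μ
  tendsto : Tendsto (fun t => ∫ o, ((r t o - 1) / t - s o) ^ 2 ∂μ) (𝓝[≠] 0) (𝓝 0)

variable {r : ℝ → Ω → ℝ} {C : ℝ} {s : Ω → ℝ}

theorem HasL2Score.eventually_memLp (h : HasL2Score μ r C s) :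
    ∀ᶠ t in 𝓝[≠] (0 : ℝ), MemLp (fun o => (r t o - 1) / t) 2 μ := by
  filter_upwards [h.bounded] with t ht
  refine MemLp.of_bound (((h.measurable t).sub_const 1).div_const t).aestronglyMeasurable
    ((C + 1) / |t|) ?_
  filter_upwards [ht] with o ho
  rw [Real.norm_eq_abs, abs_div]
  gcongr
  exact (abs_sub _ _).trans (by simpa using ho)

/-- The difference quotients stay bounded in `L²`. -/
theorem HasL2Score.eventually_integral_sq_le (h : HasL2Score μ r C s) :
    ∀ᶠ t in 𝓝[≠] (0 : ℝ),
      ∫ o, ((r t o - 1) / t) ^ 2 ∂μ ≤ 2 + 2 * ∫ o, s o ^ 2 ∂μ := by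
  filter_upwards [h.eventually_memLp, h.tendsto.eventually (gt_mem_nhds one_pos)] with t ht h1
  have hd := (ht.sub h.score_memLp).integrable_sq
  have hs := h.score_memLp.integrable_sq
  have : ∫ o, ((r t o - 1) / t) ^ 2 ∂μ ≤
      ∫ o, (2 * ((r t o - 1) / t - s o) ^ 2 + 2 * s o ^ 2) ∂μ := by
    refine integral_mono ht.integrable_sq ((hd.const_mul 2).add (hs.const_mul 2)) fun o => ?_
    change ((r t o - 1) / t) ^ 2 ≤ 2 * ((r t o - 1) / t - s o) ^ 2 + 2 * s o ^ 2
    nlinarith [sq_nonneg ((r t o - 1) / t - s o - s o)]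
  rw [integral_add (f := fun o => 2 * ((r t o - 1) / t - s o) ^ 2) (hd.const_mul 2)
    (hs.const_mul 2), integral_const_mul, integral_const_mul] at this
  linarith

theorem HasL2Score.tendsto_integral_mul (h : HasL2Score μ r C s) {g : Ω → ℝ}
    (hg : MemLp g 2 μ) :
    Tendsto (fun t => ∫ o, (r t o - 1) / t * g o ∂μ) (𝓝[≠] 0) (𝓝 (∫ o, s o * g o ∂μ)) := by
  rw [tendsto_iff_dist_tendsto_zero]
  have hlim : Tendsto (fun t => √(∫ o, ((r t o - 1) / t - s o) ^ 2 ∂μ) * √(∫ o, g o ^ 2 ∂μ))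
      (𝓝[≠] 0) (𝓝 0) := by
    simpa using (h.tendsto.sqrt).mul_const (√(∫ o, g o ^ 2 ∂μ))
  refine squeeze_zero' (Eventually.of_forall fun _ => dist_nonneg) ?_ hlim
  filter_upwards [h.eventually_memLp] with t ht
  rw [Real.dist_eq, ← integral_sub (f := fun o => (r t o - 1) / t * g o)
    (g := fun o => s o * g o) (ht.integrable_mul hg) (h.score_memLp.integrable_mul hg)]
  refine le_trans (le_of_eq ?_) (abs_integral_mul_le_sqrt (ht.sub h.score_memLp) hg)
  congr 1
  exact integral_congr_ae (Eventually.of_forall fun o => by simp [sub_mul])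

/-- The difference quotients are bounded in `L²`, so against a family tending to zero in `L²` they
contribute nothing in the limit. -/
theorem HasL2Score.tendsto_integral_mul_zero (h : HasL2Score μ r C s) {g : ℝ → Ω → ℝ}
    (hg : ∀ᶠ t in 𝓝[≠] (0 : ℝ), MemLp (g t) 2 μ)
    (hlim : Tendsto (fun t => ∫ o, g t o ^ 2 ∂μ) (𝓝[≠] 0) (𝓝 0)) :
    Tendsto (fun t => ∫ o, (r t o - 1) / t * g t o ∂μ) (𝓝[≠] 0) (𝓝 0) := by
  rw [tendsto_zero_iff_abs_tendsto_zero]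
  have hlim : Tendsto (fun t => √(2 + 2 * ∫ o, s o ^ 2 ∂μ) * √(∫ o, g t o ^ 2 ∂μ))
      (𝓝[≠] 0) (𝓝 0) := by
    simpa using (hlim.sqrt).const_mul (√(2 + 2 * ∫ o, s o ^ 2 ∂μ))
  refine squeeze_zero' (Eventually.of_forall fun _ => abs_nonneg _) ?_ hlim
  filter_upwards [h.eventually_memLp, hg, h.eventually_integral_sq_le] with t ht hgt hle
  refine (abs_integral_mul_le_sqrt ht hgt).trans ?_
  gcongr

theorem HasL2Score.tendsto_integral_abs (h : HasL2Score μ r C s) :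
    Tendsto (fun t => ∫ o, |r t o - 1| ∂μ) (𝓝[≠] 0) (𝓝 0) := by
  have hlim : Tendsto
      (fun t : ℝ => |t| * (√(2 + 2 * ∫ o, s o ^ 2 ∂μ) * √(∫ _, (1 : ℝ) ^ 2 ∂μ)))
      (𝓝[≠] 0) (𝓝 0) := by
    have h0 : Tendsto (fun t : ℝ => |t|) (𝓝[≠] 0) (𝓝 0) := by
      simpa using (continuous_abs.tendsto (0 : ℝ)).mono_left nhdsWithin_le_nhds
    simpa only [zero_mul] using
      h0.mul_const (√(2 + 2 * ∫ o, s o ^ 2 ∂μ) * √(∫ _, (1 : ℝ) ^ 2 ∂μ))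
  refine squeeze_zero' (Eventually.of_forall fun _ => integral_nonneg fun _ => abs_nonneg _) ?_
    hlim
  filter_upwards [h.eventually_memLp, h.eventually_integral_sq_le, self_mem_nhdsWithin]
    with t ht hle ht0
  have ht0 : t ≠ 0 := ht0
  have h1 := abs_integral_mul_le_sqrt ht.norm (memLp_const (1 : ℝ) (p := 2) (μ := μ))
  have h2 : ∫ o, |r t o - 1| ∂μ = |t| * ∫ o, ‖(r t o - 1) / t‖ * 1 ∂μ := by
    rw [← integral_const_mul]
    refine integral_congr_ae (Eventually.of_forall fun o => ?_)
    simp only [Real.norm_eq_abs, abs_div]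
    field_simp
  rw [h2]
  refine mul_le_mul_of_nonneg_left ((le_abs_self _).trans (h1.trans ?_)) (abs_nonneg t)
  simp only [Real.norm_eq_abs, sq_abs]
  gcongr

/-- Quadratic mean differentiability of `√r` with bounded `r` gives `L²` differentiability of `r`,
since `r - 1 = (√r - 1) (√r + 1)` and `√r + 1 → 2`. -/
theorem hasL2Score_of_sqrt (hr : ∀ t, Measurable (r t)) (hr0 : ∀ t o, 0 ≤ r t o)
    (hC : ∀ᶠ t in 𝓝[≠] (0 : ℝ), ∀ᵐ o ∂μ, r t o ≤ C) (hs : MemLp s 2 μ)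
    (hlim : Tendsto (fun t => eLpNorm (fun o => (√(r t o) - 1) / t - s o / 2) 2 μ)
      (𝓝[≠] 0) (𝓝 0)) :
    HasL2Score μ r C s := by
  have hq : ∀ t, Measurable fun o => √(r t o) := fun t => (hr t).sqrt
  have hs2 : MemLp (fun o => s o / 2) 2 μ := by
    simpa [div_eq_inv_mul] using hs.const_mul (2 : ℝ)⁻¹
  have hd : ∀ᶠ t in 𝓝[≠] (0 : ℝ), MemLp (fun o => (√(r t o) - 1) / t - s o / 2) 2 μ := by
    filter_upwards [hlim.eventually (gt_mem_nhds ENNReal.zero_lt_top)] with t ht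
    exact ⟨(((hq t).sub_const 1).div_const t).aestronglyMeasurable.sub
      hs2.aestronglyMeasurable, ht⟩
  have hD : Tendsto (fun t => ∫ o, ((√(r t o) - 1) / t - s o / 2) ^ 2 ∂μ) (𝓝[≠] 0) (𝓝 0) := by
    have h1 : Tendsto (fun t => (eLpNorm (fun o => (√(r t o) - 1) / t - s o / 2) 2 μ ^ 2).toReal)
        (𝓝[≠] 0) (𝓝 0) := by
      have h2 := ((ENNReal.continuous_pow 2).tendsto 0).comp hlim
      have h3 := (ENNReal.tendsto_toReal (by simp)).comp h2
      simpa [Function.comp_def] using h3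
    refine h1.congr' ?_
    filter_upwards [hd] with t ht
    exact (integral_sq_eq_eLpNorm_sq ht.aestronglyMeasurable).symm
  have hbd : ∀ᶠ t in 𝓝[≠] (0 : ℝ), ∀ᵐ o ∂μ, |√(r t o) - 1| ≤ √C + 1 := by
    filter_upwards [hC] with t ht
    filter_upwards [ht] with o ho
    have h1 := Real.sqrt_le_sqrt ho
    have h2 := Real.sqrt_nonneg (r t o)
    rw [abs_le]
    constructor <;> linarith
  have hb : ∀ᶠ t in 𝓝[≠] (0 : ℝ), MemLp (fun o => √(r t o) - 1) 2 μ := by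
    filter_upwards [hbd] with t ht
    exact MemLp.of_bound ((hq t).sub_const 1).aestronglyMeasurable _ ht
  -- the square root of the likelihood ratio tends to `1` in `L²`
  have hB : Tendsto (fun t => ∫ o, |(√(r t o) - 1) ^ 2| ∂μ) (𝓝[≠] 0) (𝓝 0) := by
    have h1 : Tendsto (fun t : ℝ => 2 * t ^ 2 * ((∫ o, ((√(r t o) - 1) / t - s o / 2) ^ 2 ∂μ) +
        ∫ o, (s o / 2) ^ 2 ∂μ)) (𝓝[≠] 0) (𝓝 0) := by
      have h2 : Tendsto (fun t : ℝ => 2 * t ^ 2) (𝓝[≠] 0) (𝓝 0) := by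
        have : Continuous fun t : ℝ => 2 * t ^ 2 := by fun_prop
        simpa using (this.tendsto 0).mono_left nhdsWithin_le_nhds
      simpa using h2.mul (hD.add_const (∫ o, (s o / 2) ^ 2 ∂μ))
    refine squeeze_zero' (Eventually.of_forall fun _ => integral_nonneg fun _ => abs_nonneg _)
      ?_ h1
    filter_upwards [hd, hb, self_mem_nhdsWithin] with t ht hbt ht0
    have ht0 : t ≠ 0 := ht0
    rw [← integral_add ht.integrable_sq hs2.integrable_sq, ← integral_const_mul]
    refine integral_mono hbt.integrable_sq.abs
      ((ht.integrable_sq.add hs2.integrable_sq).const_mul _) fun o => ?_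
    change |(√(r t o) - 1) ^ 2| ≤
      2 * t ^ 2 * (((√(r t o) - 1) / t - s o / 2) ^ 2 + (s o / 2) ^ 2)
    rw [abs_of_nonneg (sq_nonneg _)]
    have h3 : √(r t o) - 1 = t * ((√(r t o) - 1) / t - s o / 2) + t * (s o / 2) := by
      field_simp
      ring
    have key : ∀ q d : ℝ, q = t * d + t * (s o / 2) →
        q ^ 2 ≤ 2 * t ^ 2 * (d ^ 2 + (s o / 2) ^ 2) := by
      rintro q d rfl
      nlinarith [sq_nonneg (t * d - t * (s o / 2))]
    exact key _ _ h3
  have hSB : Tendsto (fun t => ∫ o, |s o ^ 2| * |(√(r t o) - 1) ^ 2| ∂μ) (𝓝[≠] 0) (𝓝 0) := by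
    refine tendsto_integral_abs_mul_of_bounded (K := (√C + 1) ^ 2) hs.integrable_sq
      (hb.mono fun t ht => ht.integrable_sq) ?_ hB
    filter_upwards [hbd] with t ht
    filter_upwards [ht] with o ho
    rw [abs_pow]
    gcongr
  refine ⟨hr, ?_, hs, ?_⟩
  · filter_upwards [hC] with t ht
    filter_upwards [ht] with o ho
    rwa [abs_of_nonneg (hr0 t o)]
  have hlim' : Tendsto (fun t => 2 * (√C + 1) ^ 2 *
      (∫ o, ((√(r t o) - 1) / t - s o / 2) ^ 2 ∂μ) +
        ∫ o, |s o ^ 2| * |(√(r t o) - 1) ^ 2| ∂μ) (𝓝[≠] 0) (𝓝 0) := by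
    simpa using (hD.const_mul (2 * (√C + 1) ^ 2)).add hSB
  refine squeeze_zero' (Eventually.of_forall fun _ => integral_nonneg fun _ => sq_nonneg _)
    ?_ hlim'
  filter_upwards [hd, hC, hbd, self_mem_nhdsWithin] with t ht hCt hbt ht0
  have ht0 : t ≠ 0 := ht0
  have hint : Integrable (fun o => |s o ^ 2| * |(√(r t o) - 1) ^ 2|) μ := by
    refine (hs.integrable_sq.abs.mul_bdd (c := (√C + 1) ^ 2) ?_ ?_)
    · exact ((((hq t).sub_const 1).pow_const 2).norm).aestronglyMeasurable
    · filter_upwards [hbt] with o ho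
      rw [Real.norm_eq_abs, abs_abs, abs_pow]
      gcongr
  rw [← integral_const_mul, ← integral_add (ht.integrable_sq.const_mul _) hint]
  refine integral_mono_of_nonneg (Eventually.of_forall fun o => sq_nonneg _)
    ((ht.integrable_sq.const_mul _).add hint) ?_
  filter_upwards [hCt] with o ho
  rw [abs_of_nonneg (sq_nonneg _), abs_of_nonneg (sq_nonneg _)]
  have h1 := Real.sqrt_le_sqrt ho
  have h2 := Real.sqrt_nonneg (r t o)
  have h3 : r t o = √(r t o) ^ 2 := (Real.sq_sqrt (hr0 t o)).symm
  generalize √(r t o) = q at *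
  rw [h3]
  have h4 : (q ^ 2 - 1) / t - s o =
      (q + 1) * ((q - 1) / t - s o / 2) + s o / 2 * (q - 1) := by
    field_simp
    ring
  rw [h4]
  have h5 : (q + 1) ^ 2 ≤ (√C + 1) ^ 2 := by gcongr
  have h6 := mul_le_mul_of_nonneg_right h5 (sq_nonneg ((q - 1) / t - s o / 2))
  generalize (q - 1) / t - s o / 2 = d at *
  nlinarith [sq_nonneg ((q + 1) * d - s o / 2 * (q - 1)), sq_nonneg (s o * (q - 1))]

end LikelihoodRatio

/-! ### Disintegration identities -/

section Disintegration

variable {Ω β : Type*} [MeasurableSpace Ω] [MeasurableSpace β]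

theorem measurable_condMean (P : ProbabilityMeasure Ω) (U : Ω → ℝ) (V : Ω → β) :
    Measurable (condMean P U V) := by
  unfold condMean
  exact (stronglyMeasurable_id.integral_kernel
    (κ := condDistrib U V (P : Measure Ω))).measurable

theorem lintegral_eq_lintegral_condDistrib (P : ProbabilityMeasure Ω) {U : Ω → ℝ} {V : Ω → β}
    (hU : Measurable U) (hV : Measurable V) {f : β × ℝ → ENNReal} (hf : Measurable f) :
    ∫⁻ o, f (V o, U o) ∂(P : Measure Ω) =
      ∫⁻ v, ∫⁻ u, f (v, u) ∂(condDistrib U V (P : Measure Ω) v) ∂((P : Measure Ω).map V) := by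
  rw [← Measure.lintegral_compProd hf, compProd_map_condDistrib hU.aemeasurable,
    lintegral_map hf (hV.prodMk hU)]

theorem integrable_mul_condMean (P : ProbabilityMeasure Ω) {U : Ω → ℝ} {V : Ω → β}
    (hU : Measurable U) (hV : Measurable V) {h : β → ℝ} (hh : Measurable h)
    (hint : Integrable (fun o => h (V o) * U o) (P : Measure Ω)) :
    Integrable (fun v => h v * condMean P U V v) ((P : Measure Ω).map V) := by
  have hf : Measurable fun p : β × ℝ => h p.1 * p.2 := (hh.comp measurable_fst).mul measurable_snd
  have h1 : Integrable (fun p : β × ℝ => h p.1 * p.2)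
      ((P : Measure Ω).map fun o => (V o, U o)) :=
    (integrable_map_measure hf.aestronglyMeasurable (hV.prodMk hU).aemeasurable).2 hint
  have h2 := h1.integral_condDistrib_map hU.aemeasurable
  have h3 : ∀ v, ∫ u, h v * u ∂(condDistrib U V (P : Measure Ω) v) = h v * condMean P U V v :=
    fun v => integral_const_mul _ _
  simpa only [h3] using h2

theorem integral_mul_condMean_map (P : ProbabilityMeasure Ω) {U : Ω → ℝ} {V : Ω → β}
    (hU : Measurable U) (hV : Measurable V) {h : β → ℝ} (hh : Measurable h)
    (hint : Integrable (fun o => h (V o) * U o) (P : Measure Ω)) :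
    ∫ v, h v * condMean P U V v ∂((P : Measure Ω).map V) =
      ∫ o, h (V o) * U o ∂(P : Measure Ω) := by
  have hf : Measurable fun p : β × ℝ => h p.1 * p.2 := (hh.comp measurable_fst).mul measurable_snd
  have h1 : Integrable (fun p : β × ℝ => h p.1 * p.2)
      ((P : Measure Ω).map fun o => (V o, U o)) :=
    (integrable_map_measure hf.aestronglyMeasurable (hV.prodMk hU).aemeasurable).2 hint
  have h2 : ∫ p, h p.1 * p.2 ∂((P : Measure Ω).map fun o => (V o, U o)) =
      ∫ o, h (V o) * U o ∂(P : Measure Ω) :=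
    integral_map (hV.prodMk hU).aemeasurable hf.aestronglyMeasurable
  rw [← compProd_map_condDistrib hU.aemeasurable] at h1 h2
  rw [← h2, Measure.integral_compProd h1]
  exact integral_congr_ae (Eventually.of_forall fun v => (integral_const_mul _ _).symm)

end Disintegration

/-! ### The tilting weight -/

section Weight

variable {𝒳 : Type*} [MeasurableSpace 𝒳] {δ : ℝ} {P : ProbabilityMeasure (Obs 𝒳)}

theorem measurable_covX : Measurable (covX : Obs 𝒳 → 𝒳) := measurable_fst

theorem measurable_instrZ : Measurable (instrZ : Obs 𝒳 → ℝ) := measurable_fst.comp measurable_snd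

theorem measurable_outcomeY : Measurable (outcomeY : Obs 𝒳 → ℝ) :=
  measurable_snd.comp (measurable_snd.comp measurable_snd)

theorem measurable_expoA : Measurable (expoA : Obs 𝒳 → ℝ) := by
  have h : Measurable fun b : Bool => if b then (1 : ℝ) else 0 := measurable_of_finite _
  exact h.comp (measurable_fst.comp (measurable_snd.comp measurable_snd))

theorem abs_expoA_le_one {𝒳 : Type*} (o : Obs 𝒳) : |expoA o| ≤ 1 := by
  unfold expoA
  split_ifs <;> simp

theorem measurable_exp_instrZ (δ : ℝ) :
    Measurable fun o : Obs 𝒳 => Real.exp (δ * instrZ o) :=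
  (measurable_instrZ.const_mul δ).exp

theorem measurable_alpha (δ : ℝ) (P : ProbabilityMeasure (Obs 𝒳)) : Measurable (alpha δ P) :=
  measurable_condMean _ _ _

theorem measurable_gamma (δ : ℝ) (P : ProbabilityMeasure (Obs 𝒳)) (T : Obs 𝒳 → ℝ) :
    Measurable (gamma δ P T) :=
  (measurable_condMean _ _ _).div (measurable_alpha δ P)

/-- The density `e^{δ Z} / α_δ(X)` of the tilted law of the instrument. -/
def tiltWeight (δ : ℝ) (P : ProbabilityMeasure (Obs 𝒳)) (o : Obs 𝒳) : ℝ :=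
  Real.exp (δ * instrZ o) / alpha δ P (covX o)

theorem measurable_tiltWeight (δ : ℝ) (P : ProbabilityMeasure (Obs 𝒳)) :
    Measurable (tiltWeight δ P) :=
  (measurable_exp_instrZ δ).div ((measurable_alpha δ P).comp measurable_covX)

/-- The conditional moment generating function of the instrument with values in `[0, ∞]`, which is
meaningful before finiteness is known. -/
def conditionalMGF (δ : ℝ) (P : ProbabilityMeasure (Obs 𝒳)) (x : 𝒳) : ENNReal :=
  ∫⁻ u, ENNReal.ofReal (Real.exp (δ * u)) ∂(condDistrib instrZ covX (P : Measure (Obs 𝒳)) x)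

theorem measurable_conditionalMGF (δ : ℝ) (P : ProbabilityMeasure (Obs 𝒳)) :
    Measurable (conditionalMGF δ P) :=
  Measurable.lintegral_kernel (by fun_prop)

theorem alpha_ae_eq (δ : ℝ) (P : ProbabilityMeasure (Obs 𝒳)) :
    ∀ᵐ x ∂((P : Measure (Obs 𝒳)).map covX), alpha δ P x =
      ∫ u, Real.exp (δ * u) ∂(condDistrib instrZ covX (P : Measure (Obs 𝒳)) x) := by
  have hexp : Measurable fun u : ℝ => Real.exp (δ * u) := by fun_prop
  filter_upwards [condDistrib_comp (μ := (P : Measure (Obs 𝒳))) (Y := instrZ) covX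
    measurable_instrZ.aemeasurable hexp] with x hx
  unfold alpha condMean
  have hx' : condDistrib (fun o => Real.exp (δ * instrZ o)) covX (P : Measure (Obs 𝒳)) x =
      ((condDistrib instrZ covX (P : Measure (Obs 𝒳))).map fun u => Real.exp (δ * u)) x := hx
  rw [hx', Kernel.map_apply _ hexp]
  exact integral_map hexp.aemeasurable aestronglyMeasurable_id

theorem alpha_ae_eq_toReal (δ : ℝ) (P : ProbabilityMeasure (Obs 𝒳)) :
    ∀ᵐ x ∂((P : Measure (Obs 𝒳)).map covX), alpha δ P x = (conditionalMGF δ P x).toReal := by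
  filter_upwards [alpha_ae_eq δ P] with x hx
  rw [hx, integral_eq_lintegral_of_nonneg_ae (Eventually.of_forall fun u => (Real.exp_pos _).le)
    (by fun_prop)]
  rfl

/-- Finiteness of `E(e^{δ Z} ∣ X)`. -/
abbrev TiltFinite (δ : ℝ) (P : ProbabilityMeasure (Obs 𝒳)) : Prop :=
  ∀ᵐ x ∂((P : Measure (Obs 𝒳)).map covX),
    Integrable (fun u => Real.exp (δ * u)) (condDistrib instrZ covX (P : Measure (Obs 𝒳)) x)

theorem tiltFinite_iff :
    TiltFinite δ P ↔ ∀ᵐ x ∂((P : Measure (Obs 𝒳)).map covX), conditionalMGF δ P x < ⊤ := by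
  refine eventually_congr (Eventually.of_forall fun x => ?_)
  unfold Integrable conditionalMGF
  rw [hasFiniteIntegral_iff_ofReal (Eventually.of_forall fun u => (Real.exp_pos _).le)]
  exact and_iff_right (by fun_prop)

theorem TiltFinite.alpha_pos (hP : TiltFinite δ P) :
    ∀ᵐ x ∂((P : Measure (Obs 𝒳)).map covX), 0 < alpha δ P x := by
  filter_upwards [hP, alpha_ae_eq δ P] with x hx h
  rw [h]
  exact integral_exp_pos hx

theorem TiltFinite.alpha_covX_pos (hP : TiltFinite δ P) :
    ∀ᵐ o ∂(P : Measure (Obs 𝒳)), 0 < alpha δ P (covX o) :=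
  ae_of_ae_map measurable_covX.aemeasurable hP.alpha_pos

theorem TiltFinite.ofReal_alpha (hP : TiltFinite δ P) :
    ∀ᵐ x ∂((P : Measure (Obs 𝒳)).map covX),
      ENNReal.ofReal (alpha δ P x) = conditionalMGF δ P x := by
  filter_upwards [tiltFinite_iff.1 hP, alpha_ae_eq_toReal δ P] with x hx h
  rw [h, ENNReal.ofReal_toReal hx.ne]

theorem TiltFinite.tiltWeight_pos (hP : TiltFinite δ P) :
    ∀ᵐ o ∂(P : Measure (Obs 𝒳)), 0 < tiltWeight δ P o := by
  filter_upwards [hP.alpha_covX_pos] with o ho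
  exact div_pos (Real.exp_pos _) ho

theorem TiltFinite.integrable_mul_tiltWeight (hP : TiltFinite δ P) {h : 𝒳 → ℝ}
    (hh : Measurable h) (hint : Integrable (fun o => h (covX o)) (P : Measure (Obs 𝒳))) :
    Integrable (fun o => h (covX o) * tiltWeight δ P o) (P : Measure (Obs 𝒳)) := by
  refine ⟨((hh.comp measurable_covX).mul (measurable_tiltWeight δ P)).aestronglyMeasurable, ?_⟩
  have hf : Measurable fun p : 𝒳 × ℝ =>
      ‖h p.1‖ₑ * (ENNReal.ofReal (Real.exp (δ * p.2)) / ENNReal.ofReal (alpha δ P p.1)) := by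
    have := measurable_alpha δ P
    fun_prop
  have h1 : ∫⁻ o, ‖h (covX o) * tiltWeight δ P o‖ₑ ∂(P : Measure (Obs 𝒳)) =
      ∫⁻ o, ‖h (covX o)‖ₑ * (ENNReal.ofReal (Real.exp (δ * instrZ o)) /
        ENNReal.ofReal (alpha δ P (covX o))) ∂(P : Measure (Obs 𝒳)) := by
    refine lintegral_congr_ae ?_
    filter_upwards [hP.alpha_covX_pos, hP.tiltWeight_pos] with o ho hw
    rw [enorm_mul, Real.enorm_eq_ofReal hw.le, tiltWeight, ENNReal.ofReal_div_of_pos ho]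
  have h2 : ∫⁻ x, ‖h x‖ₑ ∂((P : Measure (Obs 𝒳)).map covX) < ⊤ := by
    rw [lintegral_map hh.enorm measurable_covX]
    exact hint.2
  rw [HasFiniteIntegral, h1, lintegral_eq_lintegral_condDistrib P measurable_instrZ measurable_covX
    hf]
  refine lt_of_le_of_lt (le_of_eq (lintegral_congr_ae ?_)) h2
  filter_upwards [hP.ofReal_alpha, hP.alpha_pos] with x hx hpos
  have hne : ENNReal.ofReal (alpha δ P x) ≠ 0 := by simpa using hpos
  simp only [div_eq_mul_inv]
  rw [lintegral_const_mul _ (by fun_prop), lintegral_mul_const _ (by fun_prop)]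
  change ‖h x‖ₑ * (conditionalMGF δ P x * _) = _
  rw [← hx, ENNReal.mul_inv_cancel hne ENNReal.ofReal_ne_top, mul_one]

theorem TiltFinite.integrable_tiltWeight (hP : TiltFinite δ P) :
    Integrable (tiltWeight δ P) (P : Measure (Obs 𝒳)) := by
  simpa using hP.integrable_mul_tiltWeight (h := fun _ => 1) measurable_const (by simp)

/-- `E(e^{δ Z} / α_δ(X) ∣ X) = 1`. -/
theorem TiltFinite.integral_mul_tiltWeight (hP : TiltFinite δ P) {h : 𝒳 → ℝ}
    (hh : Measurable h) (hint : Integrable (fun o => h (covX o)) (P : Measure (Obs 𝒳))) :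
    ∫ o, h (covX o) * tiltWeight δ P o ∂(P : Measure (Obs 𝒳)) =
      ∫ o, h (covX o) ∂(P : Measure (Obs 𝒳)) := by
  have h1 : ∀ o, h (covX o) * tiltWeight δ P o =
      h (covX o) / alpha δ P (covX o) * Real.exp (δ * instrZ o) := fun o => by
    rw [tiltWeight]
    ring
  have h2 := hP.integrable_mul_tiltWeight hh hint
  simp only [h1] at h2 ⊢
  rw [← integral_mul_condMean_map P (measurable_exp_instrZ δ) measurable_covX
    (h := fun x => h x / alpha δ P x) (hh.div (measurable_alpha δ P)) h2, ← integral_map measurable_covX.aemeasurable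
    hh.aestronglyMeasurable]
  refine integral_congr_ae ?_
  filter_upwards [hP.alpha_pos] with x hx
  change h x / alpha δ P x * alpha δ P x = h x
  field_simp

/-- `γ^T_δ(X)` is a version of `E(T e^{δ Z} / α_δ(X) ∣ X)`. -/
theorem integrable_mul_gamma {T : Obs 𝒳 → ℝ} (hT : Measurable T) {h : 𝒳 → ℝ} (hh : Measurable h)
    (hint : Integrable (fun o => h (covX o) * (T o * tiltWeight δ P o)) (P : Measure (Obs 𝒳))) :
    Integrable (fun o => h (covX o) * gamma δ P T (covX o)) (P : Measure (Obs 𝒳)) := by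
  have h1 : ∀ o, h (covX o) * (T o * tiltWeight δ P o) =
      h (covX o) / alpha δ P (covX o) * (T o * Real.exp (δ * instrZ o)) := fun o => by
    rw [tiltWeight]
    ring
  simp only [h1] at hint
  have h2 := integrable_mul_condMean P (U := fun o => T o * Real.exp (δ * instrZ o))
    (hT.mul (measurable_exp_instrZ δ)) measurable_covX
    (h := fun x => h x / alpha δ P x) (hh.div (measurable_alpha δ P)) hint
  refine (h2.comp_measurable measurable_covX).congr (Eventually.of_forall fun o => ?_)
  simp only [Function.comp, gamma]
  ring

theorem integral_mul_gamma {T : Obs 𝒳 → ℝ} (hT : Measurable T) {h : 𝒳 → ℝ} (hh : Measurable h)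
    (hint : Integrable (fun o => h (covX o) * (T o * tiltWeight δ P o)) (P : Measure (Obs 𝒳))) :
    ∫ o, h (covX o) * gamma δ P T (covX o) ∂(P : Measure (Obs 𝒳)) =
      ∫ o, h (covX o) * (T o * tiltWeight δ P o) ∂(P : Measure (Obs 𝒳)) := by
  have h1 : ∀ o, h (covX o) * (T o * tiltWeight δ P o) =
      h (covX o) / alpha δ P (covX o) * (T o * Real.exp (δ * instrZ o)) := fun o => by
    rw [tiltWeight]
    ring
  simp only [h1] at hint ⊢
  rw [← integral_mul_condMean_map P (U := fun o => T o * Real.exp (δ * instrZ o))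
    (hT.mul (measurable_exp_instrZ δ)) measurable_covX
    (h := fun x => h x / alpha δ P x) (hh.div (measurable_alpha δ P)) hint,
    ← integral_map (f := fun x => h x * gamma δ P T x) measurable_covX.aemeasurable
      (hh.mul (measurable_gamma δ P T)).aestronglyMeasurable]
  refine integral_congr_ae (Eventually.of_forall fun x => ?_)
  simp only [gamma]
  ring

/-- The iterated integral that defines `tiltedMean` is a weighted mean of `T`. -/
theorem tiltedMean_eq_integral {T : Obs 𝒳 → ℝ} (hT : Measurable T)
    (hint : Integrable (fun o => T o * tiltWeight δ P o) (P : Measure (Obs 𝒳))) :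
    tiltedMean δ P T = ∫ o, T o * tiltWeight δ P o ∂(P : Measure (Obs 𝒳)) := by
  have hXZ : Measurable fun o : Obs 𝒳 => (covX o, instrZ o) :=
    measurable_covX.prodMk measurable_instrZ
  let w : 𝒳 × ℝ → ℝ := fun p => Real.exp (δ * p.2) / alpha δ P p.1
  have hw : Measurable w := by
    have := measurable_alpha δ P
    fun_prop
  have hint' : Integrable (fun o => w (covX o, instrZ o) * T o) (P : Measure (Obs 𝒳)) := by
    refine hint.congr (Eventually.of_forall fun o => ?_)
    exact mul_comm _ _
  have h1 := integral_mul_condMean_map P hT hXZ hw hint'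
  have h2 := integrable_mul_condMean P hT hXZ hw hint'
  rw [← compProd_map_condDistrib measurable_instrZ.aemeasurable] at h1 h2
  rw [Measure.integral_compProd h2] at h1
  have h3 : ∫ o, T o * tiltWeight δ P o ∂(P : Measure (Obs 𝒳)) =
      ∫ o, w (covX o, instrZ o) * T o ∂(P : Measure (Obs 𝒳)) :=
    integral_congr_ae (Eventually.of_forall fun o => mul_comm _ _)
  rw [h3, ← h1, tiltedMean]
  refine integral_congr_ae ?_
  filter_upwards [alpha_ae_eq δ P] with x hx
  rw [tiltedQ, integral_tilted, ← hx]
  rfl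

theorem alpha_zero_ae_eq (P : ProbabilityMeasure (Obs 𝒳)) :
    ∀ᵐ o ∂(P : Measure (Obs 𝒳)), alpha 0 P (covX o) = 1 := by
  filter_upwards [ae_of_ae_map measurable_covX.aemeasurable (alpha_ae_eq 0 P)] with o ho
  simp [ho]

theorem xi_eq (T : Obs 𝒳 → ℝ) (o : Obs 𝒳) :
    xi δ P T o = (T o - gamma δ P T (covX o)) * tiltWeight δ P o + gamma δ P T (covX o) := by
  rw [xi, tiltWeight]
  ring

theorem xi_zero_ae_eq (P : ProbabilityMeasure (Obs 𝒳)) (T : Obs 𝒳 → ℝ) :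
    ∀ᵐ o ∂(P : Measure (Obs 𝒳)), xi 0 P T o = T o := by
  filter_upwards [alpha_zero_ae_eq P] with o ho
  simp [xi, ho]

end Weight

/-! ### Laws with bounded likelihood ratio -/

section BoundedRatio

variable {Ω : Type*} [MeasurableSpace Ω]

/-- The likelihood ratio of `P` and `P'` is bounded by `C` in both directions. -/
structure BoundedRatio (C : NNReal) (P P' : ProbabilityMeasure Ω) : Prop where
  le : (P' : Measure Ω) ≤ C • (P : Measure Ω)
  ge : (P : Measure Ω) ≤ C • (P' : Measure Ω)

variable {C : NNReal} {P P' : ProbabilityMeasure Ω}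

theorem BoundedRatio.symm (h : BoundedRatio C P P') : BoundedRatio C P' P := ⟨h.ge, h.le⟩

theorem BoundedRatio.absolutelyContinuous (h : BoundedRatio C P P') :
    (P' : Measure Ω) ≪ (P : Measure Ω) :=
  Measure.absolutelyContinuous_of_le_smul (c := (C : ENNReal)) h.le

theorem BoundedRatio.lintegral_le (h : BoundedRatio C P P') (f : Ω → ENNReal) :
    ∫⁻ o, f o ∂(P' : Measure Ω) ≤ C * ∫⁻ o, f o ∂(P : Measure Ω) := by
  refine (lintegral_mono' h.le le_rfl).trans (le_of_eq ?_)
  rw [lintegral_smul_measure]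
  rfl

theorem BoundedRatio.integrable (h : BoundedRatio C P P') {f : Ω → ℝ}
    (hf : Integrable f (P : Measure Ω)) : Integrable f (P' : Measure Ω) :=
  hf.of_measure_le_smul (c := (C : ENNReal)) ENNReal.coe_ne_top h.le

/-- The likelihood ratio `dP'/dP` as a real function. -/
def likelihoodRatio (P P' : ProbabilityMeasure Ω) (o : Ω) : ℝ :=
  ((P' : Measure Ω).rnDeriv (P : Measure Ω) o).toReal

theorem measurable_likelihoodRatio (P P' : ProbabilityMeasure Ω) :
    Measurable (likelihoodRatio P P') :=
  (Measure.measurable_rnDeriv _ _).ennreal_toReal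

theorem likelihoodRatio_nonneg (P P' : ProbabilityMeasure Ω) (o : Ω) :
    0 ≤ likelihoodRatio P P' o := ENNReal.toReal_nonneg

theorem BoundedRatio.likelihoodRatio_le (h : BoundedRatio C P P') :
    ∀ᵐ o ∂(P : Measure Ω), likelihoodRatio P P' o ≤ C := by
  have h1 : (P' : Measure Ω).rnDeriv (P : Measure Ω) ≤ᵐ[(P : Measure Ω)] fun _ => (C : ENNReal) := by
    refine ae_le_of_forall_setLIntegral_le_of_sigmaFinite (Measure.measurable_rnDeriv _ _)
      fun s _ _ => ?_
    refine (Measure.setLIntegral_rnDeriv_le s).trans ?_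
    rw [setLIntegral_const]
    exact h.le s
  filter_upwards [h1] with o ho
  exact ENNReal.toReal_le_of_le_ofReal C.coe_nonneg (by simpa using ho)

theorem BoundedRatio.integral_likelihoodRatio_mul (h : BoundedRatio C P P') (f : Ω → ℝ) :
    ∫ o, likelihoodRatio P P' o * f o ∂(P : Measure Ω) = ∫ o, f o ∂(P' : Measure Ω) :=
  integral_rnDeriv_smul h.absolutelyContinuous

theorem BoundedRatio.integrable_likelihoodRatio_sub_one_mul (h : BoundedRatio C P P') {f : Ω → ℝ}
    (hf : Integrable f (P : Measure Ω)) :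
    Integrable (fun o => (likelihoodRatio P P' o - 1) * f o) (P : Measure Ω) := by
  refine hf.bdd_mul (c := (C : ℝ) + 1)
    ((measurable_likelihoodRatio P P').sub_const 1).aestronglyMeasurable ?_
  filter_upwards [h.likelihoodRatio_le] with o ho
  rw [Real.norm_eq_abs, abs_le]
  have := likelihoodRatio_nonneg P P' o
  have := C.coe_nonneg
  constructor <;> linarith

theorem BoundedRatio.integral_sub_integral (h : BoundedRatio C P P') {f : Ω → ℝ}
    (hf : Integrable f (P : Measure Ω)) :
    ∫ o, f o ∂(P' : Measure Ω) - ∫ o, f o ∂(P : Measure Ω) =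
      ∫ o, (likelihoodRatio P P' o - 1) * f o ∂(P : Measure Ω) := by
  have h1 : Integrable (fun o => likelihoodRatio P P' o * f o) (P : Measure Ω) := by
    refine ((h.integrable_likelihoodRatio_sub_one_mul hf).add hf).congr
      (Eventually.of_forall fun o => ?_)
    simp only [Pi.add_apply]
    ring
  rw [← h.integral_likelihoodRatio_mul f, ← integral_sub h1 hf]
  refine integral_congr_ae (Eventually.of_forall fun o => ?_)
  simp only
  ring

end BoundedRatio

/-! ### Comparison of the tilting weights -/

section Comparison

variable {𝒳 : Type*} [MeasurableSpace 𝒳] {δ : ℝ} {C : NNReal} {P P' : ProbabilityMeasure (Obs 𝒳)}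

theorem BoundedRatio.map_absolutelyContinuous (h : BoundedRatio C P P') :
    (P' : Measure (Obs 𝒳)).map covX ≪ (P : Measure (Obs 𝒳)).map covX :=
  h.absolutelyContinuous.map measurable_covX

theorem BoundedRatio.conditionalMGF_le (h : BoundedRatio C P P') :
    ∀ᵐ x ∂((P : Measure (Obs 𝒳)).map covX),
      conditionalMGF δ P x ≤ (C * C : ENNReal) * conditionalMGF δ P' x := by
  refine ae_le_of_forall_setLIntegral_le_of_sigmaFinite (measurable_conditionalMGF δ P)
    fun s hs _ => ?_
  let f : 𝒳 × ℝ → ENNReal := fun p =>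
    s.indicator (fun _ => 1) p.1 * ENNReal.ofReal (Real.exp (δ * p.2))
  have hf : Measurable f := by
    have : Measurable fun p : 𝒳 × ℝ => s.indicator (fun _ => (1 : ENNReal)) p.1 :=
      (measurable_const.indicator hs).comp measurable_fst
    fun_prop
  -- both conditional moment generating functions, integrated over `s`, are moments of `(X, Z)`
  have key : ∀ R : ProbabilityMeasure (Obs 𝒳), ∫⁻ o, f (covX o, instrZ o) ∂(R : Measure (Obs 𝒳)) =
      ∫⁻ o, s.indicator (conditionalMGF δ R) (covX o) ∂(R : Measure (Obs 𝒳)) := fun R => by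
    rw [lintegral_eq_lintegral_condDistrib R measurable_instrZ measurable_covX hf,
      ← lintegral_map ((measurable_conditionalMGF δ R).indicator hs) measurable_covX]
    refine lintegral_congr fun x => ?_
    by_cases hx : x ∈ s
    · simp [f, hx, conditionalMGF]
    · simp [f, hx]
  have hmap : ∀ g : 𝒳 → ENNReal, Measurable g →
      ∫⁻ x in s, g x ∂((P : Measure (Obs 𝒳)).map covX) =
        ∫⁻ o, s.indicator g (covX o) ∂(P : Measure (Obs 𝒳)) := fun g hg => by
    rw [← lintegral_indicator hs, lintegral_map (hg.indicator hs) measurable_covX]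
  rw [lintegral_const_mul _ (measurable_conditionalMGF δ P'),
    hmap _ (measurable_conditionalMGF δ P), hmap _ (measurable_conditionalMGF δ P'), ← key P]
  calc ∫⁻ o, f (covX o, instrZ o) ∂(P : Measure (Obs 𝒳))
      ≤ C * ∫⁻ o, f (covX o, instrZ o) ∂(P' : Measure (Obs 𝒳)) := h.symm.lintegral_le _
    _ = C * ∫⁻ o, s.indicator (conditionalMGF δ P') (covX o) ∂(P' : Measure (Obs 𝒳)) := by
        rw [key P']
    _ ≤ C * (C * ∫⁻ o, s.indicator (conditionalMGF δ P') (covX o) ∂(P : Measure (Obs 𝒳))) := by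
        gcongr
        exact h.lintegral_le _
    _ = _ := by rw [mul_assoc]

theorem BoundedRatio.tiltFinite (h : BoundedRatio C P P') (hP : TiltFinite δ P) :
    TiltFinite δ P' := by
  rw [tiltFinite_iff] at hP ⊢
  filter_upwards [h.symm.conditionalMGF_le (δ := δ), h.map_absolutelyContinuous.ae_le hP]
    with x hx hfin
  exact hx.trans_lt (ENNReal.mul_lt_top (by simp [ENNReal.mul_lt_top]) hfin)

theorem BoundedRatio.alpha_le (h : BoundedRatio C P P') (hP : TiltFinite δ P) :
    ∀ᵐ o ∂(P : Measure (Obs 𝒳)), alpha δ P (covX o) ≤ (C : ℝ) ^ 2 * alpha δ P' (covX o) := by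
  refine ae_of_ae_map (p := fun x => alpha δ P x ≤ (C : ℝ) ^ 2 * alpha δ P' x)
    measurable_covX.aemeasurable ?_
  filter_upwards [h.conditionalMGF_le (δ := δ), alpha_ae_eq_toReal δ P,
    h.symm.map_absolutelyContinuous.ae_le (alpha_ae_eq_toReal δ P'),
    h.symm.map_absolutelyContinuous.ae_le (tiltFinite_iff.1 (h.tiltFinite hP))] with x hx h1 h2 hfin
  rw [h1, h2]
  have := ENNReal.toReal_mono (ENNReal.mul_ne_top (by simp [ENNReal.mul_eq_top]) hfin.ne) hx
  simpa [sq] using this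

/-- The ratio `α_δ(x; P) / α_δ(x; P')`, by which the tilting weights of `P'` and `P` differ. -/
def alphaRatio (δ : ℝ) (P P' : ProbabilityMeasure (Obs 𝒳)) (x : 𝒳) : ℝ :=
  alpha δ P x / alpha δ P' x

theorem measurable_alphaRatio : Measurable (alphaRatio δ P P') :=
  (measurable_alpha δ P).div (measurable_alpha δ P')

theorem BoundedRatio.alpha_pos (h : BoundedRatio C P P') (hP : TiltFinite δ P) :
    ∀ᵐ o ∂(P : Measure (Obs 𝒳)), 0 < alpha δ P' (covX o) :=
  h.symm.absolutelyContinuous.ae_le (h.tiltFinite hP).alpha_covX_pos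

theorem BoundedRatio.tiltWeight_eq (h : BoundedRatio C P P') (hP : TiltFinite δ P) :
    ∀ᵐ o ∂(P : Measure (Obs 𝒳)),
      tiltWeight δ P' o = tiltWeight δ P o * alphaRatio δ P P' (covX o) := by
  filter_upwards [hP.alpha_covX_pos, h.alpha_pos hP] with o h1 h2
  simp only [tiltWeight, alphaRatio]
  field_simp

theorem BoundedRatio.abs_alphaRatio_le (h : BoundedRatio C P P') (hP : TiltFinite δ P) :
    ∀ᵐ o ∂(P : Measure (Obs 𝒳)), |alphaRatio δ P P' (covX o)| ≤ (C : ℝ) ^ 2 := by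
  filter_upwards [hP.alpha_covX_pos, h.alpha_pos hP, h.alpha_le hP] with o h1 h2 h3
  rw [alphaRatio, abs_of_pos (div_pos h1 h2)]
  exact (div_le_iff₀ h2).2 h3

theorem BoundedRatio.abs_alphaRatio_sub_one_le (h : BoundedRatio C P P') (hP : TiltFinite δ P) :
    ∀ᵐ o ∂(P : Measure (Obs 𝒳)), |alphaRatio δ P P' (covX o) - 1| ≤ (C : ℝ) ^ 2 + 1 := by
  filter_upwards [h.abs_alphaRatio_le hP] with o ho
  exact (abs_sub _ _).trans (by simpa using ho)

theorem BoundedRatio.integrable_mul_tiltWeight (h : BoundedRatio C P P') (hP : TiltFinite δ P)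
    {T : Obs 𝒳 → ℝ} (hint : Integrable (fun o => T o * tiltWeight δ P o) (P : Measure (Obs 𝒳))) :
    Integrable (fun o => T o * tiltWeight δ P' o) (P' : Measure (Obs 𝒳)) := by
  refine h.integrable ?_
  refine (hint.mul_bdd (c := (C : ℝ) ^ 2)
    (measurable_alphaRatio.comp measurable_covX).aestronglyMeasurable
    (h.abs_alphaRatio_le hP)).congr ?_
  filter_upwards [h.tiltWeight_eq hP] with o ho
  simp only [Function.comp]
  rw [ho, mul_assoc]

/-- Except for relevance, membership in the nonparametric model is inherited by every law with
bounded likelihood ratio. -/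
theorem BoundedRatio.inModel (h : BoundedRatio C P P') (hP : InModel δ P)
    (hrel : tiltedMean δ P' expoA ≠ ∫ o, expoA o ∂(P' : Measure (Obs 𝒳))) : InModel δ P' where
  continuous_instrument := by
    have h1 : (P' : Measure (Obs 𝒳)).map covX ⊗ₘ condDistrib instrZ covX (P' : Measure (Obs 𝒳)) ≪
        (P : Measure (Obs 𝒳)).map covX ⊗ₘ condDistrib instrZ covX (P : Measure (Obs 𝒳)) := by
      rw [compProd_map_condDistrib measurable_instrZ.aemeasurable,
        compProd_map_condDistrib measurable_instrZ.aemeasurable]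
      exact h.absolutelyContinuous.map (measurable_covX.prodMk measurable_instrZ)
    have h2 := Measure.absolutelyContinuous_compProd_right_iff.1
      (Measure.absolutelyContinuous_compProd_of_compProd h1)
    filter_upwards [h2, h.map_absolutelyContinuous.ae_le hP.continuous_instrument] with x hx hx'
    exact hx.trans hx'
  tilt_finite := h.tiltFinite hP.tilt_finite
  integrable_outcome := h.integrable hP.integrable_outcome
  integrable_tilted_outcome :=
    h.integrable_mul_tiltWeight hP.tilt_finite hP.integrable_tilted_outcome
  relevance := hrel

end Comparison

/-! ### First-order expansion of the tilted mean -/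

section Expansion

variable {𝒳 : Type*} [MeasurableSpace 𝒳] {δ : ℝ} {C : NNReal} {P P' : ProbabilityMeasure (Obs 𝒳)}
  {T : Obs 𝒳 → ℝ}

/-- The weighted residual `(T - γ^T_δ(X)) e^{δ Z} / α_δ(X)`, which has conditional mean zero
given `X`. -/
def tiltResidual (δ : ℝ) (P : ProbabilityMeasure (Obs 𝒳)) (T : Obs 𝒳 → ℝ) (o : Obs 𝒳) : ℝ :=
  (T o - gamma δ P T (covX o)) * tiltWeight δ P o

theorem integrable_gamma (hT : Measurable T)
    (hint : Integrable (fun o => T o * tiltWeight δ P o) (P : Measure (Obs 𝒳))) :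
    Integrable (fun o => gamma δ P T (covX o)) (P : Measure (Obs 𝒳)) := by
  simpa using integrable_mul_gamma hT (h := fun _ => 1) measurable_const (by simpa using hint)

theorem measurable_tiltResidual (hT : Measurable T) : Measurable (tiltResidual δ P T) :=
  (hT.sub ((measurable_gamma δ P T).comp measurable_covX)).mul (measurable_tiltWeight δ P)

theorem TiltFinite.integrable_tiltResidual (hP : TiltFinite δ P) (hT : Measurable T)
    (hint : Integrable (fun o => T o * tiltWeight δ P o) (P : Measure (Obs 𝒳))) :
    Integrable (tiltResidual δ P T) (P : Measure (Obs 𝒳)) := by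
  refine (hint.sub (hP.integrable_mul_tiltWeight (measurable_gamma δ P T)
    (integrable_gamma hT hint))).congr (Eventually.of_forall fun o => ?_)
  simp only [tiltResidual, Pi.sub_apply]
  ring

theorem TiltFinite.integral_mul_tiltResidual (hP : TiltFinite δ P) (hT : Measurable T)
    (hint : Integrable (fun o => T o * tiltWeight δ P o) (P : Measure (Obs 𝒳)))
    {h : 𝒳 → ℝ} (hh : Measurable h) {K : ℝ}
    (hK : ∀ᵐ o ∂(P : Measure (Obs 𝒳)), |h (covX o)| ≤ K) :
    ∫ o, h (covX o) * tiltResidual δ P T o ∂(P : Measure (Obs 𝒳)) = 0 := by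
  have hm : AEStronglyMeasurable (fun o => h (covX o)) (P : Measure (Obs 𝒳)) :=
    (hh.comp measurable_covX).aestronglyMeasurable
  have h1 := hint.bdd_mul hm hK
  have h2 := (integrable_gamma hT hint).bdd_mul hm hK
  have hg : Measurable fun x => h x * gamma δ P T x := hh.mul (measurable_gamma δ P T)
  have h3 := hP.integrable_mul_tiltWeight hg h2
  have h4 : ∀ o, h (covX o) * tiltResidual δ P T o =
      h (covX o) * (T o * tiltWeight δ P o) -
        h (covX o) * gamma δ P T (covX o) * tiltWeight δ P o := fun o => by
    rw [tiltResidual]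
    ring
  simp only [h4]
  rw [integral_sub h1 h3, hP.integral_mul_tiltWeight hg h2, integral_mul_gamma hT hh h1, sub_self]

theorem TiltFinite.integral_mul_tiltWeight_sub_one (hP : TiltFinite δ P)
    {h : 𝒳 → ℝ} (hh : Measurable h)
    (hint : Integrable (fun o => h (covX o)) (P : Measure (Obs 𝒳))) :
    ∫ o, h (covX o) * (tiltWeight δ P o - 1) ∂(P : Measure (Obs 𝒳)) = 0 := by
  simp only [mul_sub, mul_one]
  rw [integral_sub (hP.integrable_mul_tiltWeight hh hint) hint, hP.integral_mul_tiltWeight hh hint,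
    sub_self]

/-- Under `P'` the tilted mean is `E_{P'} ξ(T; δ)`, with `ξ` computed under `P`, up to a remainder
that is a product of the two deviations `dP'/dP - 1` and `α_δ(X; P)/α_δ(X; P') - 1`. -/
theorem BoundedRatio.tiltedMean_eq (h : BoundedRatio C P P') (hP : TiltFinite δ P)
    (hT : Measurable T)
    (hint : Integrable (fun o => T o * tiltWeight δ P o) (P : Measure (Obs 𝒳))) :
    tiltedMean δ P' T = ∫ o, xi δ P T o ∂(P' : Measure (Obs 𝒳)) +
      ∫ o, (likelihoodRatio P P' o - 1) *
        ((alphaRatio δ P P' (covX o) - 1) * tiltResidual δ P T o) ∂(P : Measure (Obs 𝒳)) := by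
  have hP' := h.tiltFinite hP
  have hint' := h.integrable_mul_tiltWeight hP hint
  have hD := hP.integrable_tiltResidual hT hint
  have hγ := integrable_gamma hT hint
  have hbm : Measurable fun x => alphaRatio δ P P' x - 1 := measurable_alphaRatio.sub_const 1
  have hbD : Integrable (fun o => (alphaRatio δ P P' (covX o) - 1) * tiltResidual δ P T o)
      (P : Measure (Obs 𝒳)) :=
    hD.bdd_mul (hbm.comp measurable_covX).aestronglyMeasurable (h.abs_alphaRatio_sub_one_le hP)
  have hxi : ∫ o, xi δ P T o ∂(P' : Measure (Obs 𝒳)) =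
      ∫ o, tiltResidual δ P T o ∂(P' : Measure (Obs 𝒳)) +
        ∫ o, gamma δ P T (covX o) ∂(P' : Measure (Obs 𝒳)) := by
    rw [← integral_add (h.integrable hD) (h.integrable hγ)]
    exact integral_congr_ae (Eventually.of_forall fun o => xi_eq T o)
  have hw : ∫ o, T o * tiltWeight δ P' o ∂(P' : Measure (Obs 𝒳)) =
      ∫ o, (alphaRatio δ P P' (covX o) - 1) * tiltResidual δ P T o ∂(P' : Measure (Obs 𝒳)) +
        ∫ o, tiltResidual δ P T o ∂(P' : Measure (Obs 𝒳)) +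
        ∫ o, gamma δ P T (covX o) * tiltWeight δ P' o ∂(P' : Measure (Obs 𝒳)) := by
    rw [← integral_add (h.integrable hbD) (h.integrable hD),
      ← integral_add (f := fun o => (alphaRatio δ P P' (covX o) - 1) * tiltResidual δ P T o +
        tiltResidual δ P T o) ((h.integrable hbD).add (h.integrable hD))
        (hP'.integrable_mul_tiltWeight (measurable_gamma δ P T) (h.integrable hγ))]
    refine integral_congr_ae ?_
    filter_upwards [h.absolutelyContinuous.ae_le (h.tiltWeight_eq hP)] with o ho
    rw [ho, tiltResidual]
    ring
  have hR := h.integral_sub_integral hbD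
  rw [hP.integral_mul_tiltResidual hT hint hbm (h.abs_alphaRatio_sub_one_le hP), sub_zero] at hR
  rw [tiltedMean_eq_integral hT hint', hw,
    hP'.integral_mul_tiltWeight (measurable_gamma δ P T) (h.integrable hγ), hxi, ← hR]
  ring

theorem TiltFinite.integral_xi (hP : TiltFinite δ P) (hT : Measurable T)
    (hint : Integrable (fun o => T o * tiltWeight δ P o) (P : Measure (Obs 𝒳))) :
    ∫ o, xi δ P T o ∂(P : Measure (Obs 𝒳)) = tiltedMean δ P T := by
  have h1 := hP.integral_mul_tiltResidual hT hint (h := fun _ => 1) (K := 1) measurable_const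
    (by simp)
  have h2 := integral_mul_gamma (P := P) (δ := δ) hT (h := fun _ => 1) measurable_const
    (by simpa using hint)
  simp only [one_mul] at h1 h2
  have h3 : ∀ o, xi δ P T o = tiltResidual δ P T o + gamma δ P T (covX o) := xi_eq T
  simp only [h3]
  rw [integral_add (hP.integrable_tiltResidual hT hint) (integrable_gamma hT hint), h1, h2,
    zero_add, tiltedMean_eq_integral hT hint]

/-- The deviation of the ratio of normalizers is controlled in `L¹` by that of the likelihood
ratio. -/
theorem BoundedRatio.integral_abs_alphaRatio_sub_one_le (h : BoundedRatio C P P')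
    (hP : TiltFinite δ P) :
    ∫ o, |alphaRatio δ P P' (covX o) - 1| ∂(P : Measure (Obs 𝒳)) ≤
      (C : ℝ) ^ 3 * ∫ o, |tiltWeight δ P o - 1| * |likelihoodRatio P P' o - 1|
        ∂(P : Measure (Obs 𝒳)) := by
  have hP' := h.tiltFinite hP
  have hw := hP.integrable_tiltWeight
  have ham : Measurable (alphaRatio δ P P') := measurable_alphaRatio
  -- the sign of the deviation, as a function of the covariates
  let σ : 𝒳 → ℝ := fun x => if 1 ≤ alphaRatio δ P P' x then 1 else -1
  have hσm : Measurable σ :=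
    Measurable.ite (measurableSet_le measurable_const ham) measurable_const measurable_const
  have hσ1 : ∀ x, |σ x| = 1 := fun x => by
    simp only [σ]
    split_ifs <;> simp
  have hσa : ∀ x, |alphaRatio δ P P' x - 1| = σ x * alphaRatio δ P P' x - σ x := fun x => by
    simp only [σ]
    split_ifs with hx
    · rw [abs_of_nonneg (by linarith)]
      ring
    · rw [abs_of_nonpos (by linarith)]
      ring
  have hσa_le : ∀ᵐ o ∂(P : Measure (Obs 𝒳)),
      |σ (covX o) * alphaRatio δ P P' (covX o)| ≤ (C : ℝ) ^ 2 := by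
    filter_upwards [h.abs_alphaRatio_le hP] with o ho
    rwa [abs_mul, hσ1, one_mul]
  have hm : Measurable fun x => σ x * alphaRatio δ P P' x := hσm.mul ham
  have hmo : AEStronglyMeasurable (fun o => σ (covX o) * alphaRatio δ P P' (covX o))
      (P : Measure (Obs 𝒳)) := (hm.comp measurable_covX).aestronglyMeasurable
  have hi1 : Integrable (fun o => σ (covX o) * alphaRatio δ P P' (covX o))
      (P : Measure (Obs 𝒳)) := Integrable.of_bound hmo _ hσa_le
  have hi2 : Integrable (fun o => σ (covX o)) (P : Measure (Obs 𝒳)) :=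
    Integrable.of_bound (hσm.comp measurable_covX).aestronglyMeasurable 1
      (Eventually.of_forall fun o => (hσ1 _).le)
  have hi3 : Integrable (fun o => σ (covX o) * alphaRatio δ P P' (covX o) *
      (tiltWeight δ P o - 1)) (P : Measure (Obs 𝒳)) :=
    (hw.sub (integrable_const 1)).bdd_mul hmo hσa_le
  have hi4 : Integrable (fun o => |tiltWeight δ P o - 1| * |likelihoodRatio P P' o - 1|)
      (P : Measure (Obs 𝒳)) := by
    refine (h.integrable_likelihoodRatio_sub_one_mul (hw.sub (integrable_const 1))).abs.congr
      (Eventually.of_forall fun o => ?_)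
    simp [abs_mul, mul_comm]
  have habs : Integrable (fun o => |alphaRatio δ P P' (covX o) - 1|) (P : Measure (Obs 𝒳)) := by
    simp only [hσa]
    exact hi1.sub hi2
  have h1 : ∫ o, |alphaRatio δ P P' (covX o) - 1| ∂(P : Measure (Obs 𝒳)) ≤
      C * ∫ o, |alphaRatio δ P P' (covX o) - 1| ∂(P' : Measure (Obs 𝒳)) := by
    have h2 := integral_mono_measure h.ge (Eventually.of_forall fun o => abs_nonneg _)
      ((h.integrable habs).smul_measure_nnreal (c := C))
    rw [integral_smul_nnreal_measure] at h2
    exact h2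
  -- under `P'` both weights average to one given `X`, and `w' = w α / α'`
  have h2 : ∫ o, |alphaRatio δ P P' (covX o) - 1| ∂(P' : Measure (Obs 𝒳)) =
      -∫ o, σ (covX o) * alphaRatio δ P P' (covX o) * (tiltWeight δ P o - 1)
        ∂(P' : Measure (Obs 𝒳)) := by
    simp only [hσa]
    rw [integral_sub (h.integrable hi1) (h.integrable hi2),
      ← hP'.integral_mul_tiltWeight hσm (h.integrable hi2),
      ← integral_sub (h.integrable hi1)
        (hP'.integrable_mul_tiltWeight hσm (h.integrable hi2)), ← integral_neg]
    refine integral_congr_ae ?_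
    filter_upwards [h.absolutelyContinuous.ae_le (h.tiltWeight_eq hP)] with o ho
    rw [ho]
    ring
  have h3 := h.integral_sub_integral hi3
  rw [hP.integral_mul_tiltWeight_sub_one hm hi1, sub_zero] at h3
  have h4 : -∫ o, σ (covX o) * alphaRatio δ P P' (covX o) * (tiltWeight δ P o - 1)
        ∂(P' : Measure (Obs 𝒳)) ≤
      (C : ℝ) ^ 2 * ∫ o, |tiltWeight δ P o - 1| * |likelihoodRatio P P' o - 1|
        ∂(P : Measure (Obs 𝒳)) := by
    rw [h3]
    refine (neg_le_abs _).trans (abs_integral_le_integral_abs.trans ?_)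
    rw [← integral_const_mul]
    refine integral_mono_of_nonneg (Eventually.of_forall fun o => abs_nonneg _)
      (hi4.const_mul _) ?_
    filter_upwards [hσa_le] with o ho
    rw [abs_mul, abs_mul (σ (covX o) * alphaRatio δ P P' (covX o))]
    calc |likelihoodRatio P P' o - 1| * (|σ (covX o) * alphaRatio δ P P' (covX o)| *
          |tiltWeight δ P o - 1|)
        = |σ (covX o) * alphaRatio δ P P' (covX o)| *
          (|tiltWeight δ P o - 1| * |likelihoodRatio P P' o - 1|) := by ring
      _ ≤ _ := by gcongr
  calc _ ≤ _ := h1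
    _ ≤ C * ((C : ℝ) ^ 2 * ∫ o, |tiltWeight δ P o - 1| * |likelihoodRatio P P' o - 1|
        ∂(P : Measure (Obs 𝒳))) := by
      rw [h2]
      gcongr
    _ = _ := by ring

end Expansion

/-! ### Differentiation along paths -/

section PathDerivative

variable {Ω : Type*} [MeasurableSpace Ω] {C : NNReal} {P : ProbabilityMeasure Ω}
  {path : ℝ → ProbabilityMeasure Ω} {s : Ω → ℝ}

/-- A path through `P` with bounded likelihood ratios, differentiable in quadratic mean, and subject
to no model: membership of the perturbed laws in the model is not needed to differentiate. -/
structure IsDifferentiablePath (C : NNReal) (P : ProbabilityMeasure Ω)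
    (path : ℝ → ProbabilityMeasure Ω) (s : Ω → ℝ) : Prop where
  at_zero : path 0 = P
  bounded : ∀ᶠ t in 𝓝 (0 : ℝ), BoundedRatio C P (path t)
  hasL2Score : HasL2Score (P : Measure Ω) (fun t => likelihoodRatio P (path t)) C s

theorem isDifferentiablePath_of_quadratic_mean (h0 : path 0 = P)
    (hb : ∀ᶠ t in 𝓝 (0 : ℝ), BoundedRatio C P (path t)) (hs : MemLp s 2 (P : Measure Ω))
    (hlim : Tendsto (fun t : ℝ => eLpNorm (fun o =>
        (√((path t : Measure Ω).rnDeriv (P : Measure Ω) o).toReal - 1) / t - s o / 2) 2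
          (P : Measure Ω)) (𝓝[≠] 0) (𝓝 0)) :
    IsDifferentiablePath C P path s :=
  ⟨h0, hb, hasL2Score_of_sqrt (fun t => measurable_likelihoodRatio P (path t))
    (fun t => likelihoodRatio_nonneg P (path t))
    ((hb.filter_mono nhdsWithin_le_nhds).mono fun _ ht => ht.likelihoodRatio_le) hs hlim⟩

theorem IsRegularSubmodel.exists_isDifferentiablePath {M : Set (ProbabilityMeasure Ω)}
    (h : IsRegularSubmodel M P path s) : ∃ C, IsDifferentiablePath C P path s := by
  obtain ⟨C, hC⟩ := h.bounded_ratio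
  exact ⟨C, isDifferentiablePath_of_quadratic_mean h.at_zero (hC.mono fun t ht => ⟨ht.1, ht.2⟩)
    h.score_memLp h.quadratic_mean⟩

theorem IsDifferentiablePath.hasDerivAt_integral (h : IsDifferentiablePath C P path s)
    {g : Ω → ℝ} (hg : MemLp g 2 (P : Measure Ω)) :
    HasDerivAt (fun t => ∫ o, g o ∂(path t : Measure Ω)) (∫ o, g o * s o ∂(P : Measure Ω)) 0 := by
  rw [hasDerivAt_iff_tendsto_slope_zero]
  have h1 := h.hasL2Score.tendsto_integral_mul hg
  simp only [mul_comm (s _)] at h1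
  refine h1.congr' ?_
  filter_upwards [h.bounded.filter_mono nhdsWithin_le_nhds] with t ht
  rw [zero_add, h.at_zero, ht.integral_sub_integral (hg.integrable one_le_two), smul_eq_mul,
    ← integral_const_mul]
  exact integral_congr_ae (Eventually.of_forall fun o => by ring)

/-- Scores have mean zero, as the total mass is constant along the path. -/
theorem IsDifferentiablePath.integral_score (h : IsDifferentiablePath C P path s) :
    ∫ o, s o ∂(P : Measure Ω) = 0 := by
  have h1 := h.hasDerivAt_integral (g := fun _ => 1) (memLp_const 1)
  simp only [one_mul, integral_const, probReal_univ, smul_eq_mul, mul_one] at h1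
  exact h1.unique (hasDerivAt_const _ _)

end PathDerivative

section TiltedDerivative

variable {𝒳 : Type*} [MeasurableSpace 𝒳] {δ : ℝ} {C : NNReal} {P : ProbabilityMeasure (Obs 𝒳)}
  {T : Obs 𝒳 → ℝ} {path : ℝ → ProbabilityMeasure (Obs 𝒳)} {s : Obs 𝒳 → ℝ}

/-- Square integrability passes from `ξ(T; δ)` to `γ^T_δ(X) = E(ξ(T; δ) ∣ X)`. -/
theorem TiltFinite.memLp_gamma (hP : TiltFinite δ P) (hT : Measurable T)
    (hint : Integrable (fun o => T o * tiltWeight δ P o) (P : Measure (Obs 𝒳)))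
    (hξ : MemLp (xi δ P T) 2 (P : Measure (Obs 𝒳))) :
    MemLp (fun o => gamma δ P T (covX o)) 2 (P : Measure (Obs 𝒳)) := by
  have hγ := integrable_gamma hT hint
  have hcond : (fun o => gamma δ P T (covX o)) =ᵐ[(P : Measure (Obs 𝒳))]
      (P : Measure (Obs 𝒳))[xi δ P T | MeasurableSpace.comap covX inferInstance] := by
    refine ae_eq_condExp_of_forall_setIntegral_eq measurable_covX.comap_le
      (hξ.integrable one_le_two) (fun _ _ _ => hγ.integrableOn) ?_
      ((measurable_gamma δ P T).comp (comap_measurable covX)).aestronglyMeasurable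
    rintro _ ⟨B, hB, rfl⟩ -
    have h1 := hP.integral_mul_tiltResidual hT hint (h := B.indicator fun _ => 1) (K := 1)
      (measurable_const.indicator hB) (Eventually.of_forall fun o => by
        by_cases ho : covX o ∈ B <;> simp [ho])
    have h2 : ∫ o in covX ⁻¹' B, tiltResidual δ P T o ∂(P : Measure (Obs 𝒳)) = 0 := by
      rw [← integral_indicator (measurable_covX hB), ← h1]
      refine integral_congr_ae (Eventually.of_forall fun o => ?_)
      by_cases ho : covX o ∈ B <;> simp [ho]
    have h3 : ∀ o, xi δ P T o = tiltResidual δ P T o + gamma δ P T (covX o) := xi_eq T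
    simp only [h3]
    rw [integral_add (hP.integrable_tiltResidual hT hint).integrableOn hγ.integrableOn, h2,
      zero_add]
  exact (hξ.condExp one_le_two).ae_eq hcond.symm

theorem TiltFinite.memLp_tiltResidual (hP : TiltFinite δ P) (hT : Measurable T)
    (hint : Integrable (fun o => T o * tiltWeight δ P o) (P : Measure (Obs 𝒳)))
    (hξ : MemLp (xi δ P T) 2 (P : Measure (Obs 𝒳))) :
    MemLp (tiltResidual δ P T) 2 (P : Measure (Obs 𝒳)) := by
  refine (hξ.sub (hP.memLp_gamma hT hint hξ)).ae_eq (Eventually.of_forall fun o => ?_)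
  simp [xi_eq, tiltResidual]

/-- The tilted mean is differentiable along paths, with gradient `ξ(T; δ)`: the remainder in
`BoundedRatio.tiltedMean_eq` is `O(t)` in `L²` times `o(1)` in `L²`. -/
theorem IsDifferentiablePath.hasDerivAt_tiltedMean (h : IsDifferentiablePath C P path s)
    (hP : TiltFinite δ P) (hT : Measurable T)
    (hint : Integrable (fun o => T o * tiltWeight δ P o) (P : Measure (Obs 𝒳)))
    (hξ : MemLp (xi δ P T) 2 (P : Measure (Obs 𝒳))) :
    HasDerivAt (fun t => tiltedMean δ (path t) T)
      (∫ o, xi δ P T o * s o ∂(P : Measure (Obs 𝒳))) 0 := by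
  have hD := hP.memLp_tiltResidual hT hint hξ
  have hb : ∀ᶠ t in 𝓝[≠] (0 : ℝ), BoundedRatio C P (path t) :=
    h.bounded.filter_mono nhdsWithin_le_nhds
  have ham : ∀ t, Measurable fun o => alphaRatio δ P (path t) (covX o) - 1 := fun t =>
    (measurable_alphaRatio.comp measurable_covX).sub_const 1
  -- the likelihood ratio tends to one in `L¹`, also when weighted by the tilting weight
  have hr : Tendsto (fun t => ∫ o, |tiltWeight δ P o - 1| *
      |likelihoodRatio P (path t) o - 1| ∂(P : Measure (Obs 𝒳))) (𝓝[≠] 0) (𝓝 0) := by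
    refine tendsto_integral_abs_mul_of_bounded (K := (C : ℝ) + 1)
      (hP.integrable_tiltWeight.sub (integrable_const 1)) ?_ ?_ h.hasL2Score.tendsto_integral_abs
    · filter_upwards [hb] with t ht
      simpa using ht.integrable_likelihoodRatio_sub_one_mul (f := fun _ => 1) (integrable_const 1)
    · filter_upwards [h.hasL2Score.bounded] with t ht
      filter_upwards [ht] with o ho
      exact (abs_sub _ _).trans (by simpa using ho)
  -- hence so does the ratio of normalizers
  have hα : Tendsto (fun t => ∫ o, |alphaRatio δ P (path t) (covX o) - 1|
      ∂(P : Measure (Obs 𝒳))) (𝓝[≠] 0) (𝓝 0) := by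
    have h1 := hr.const_mul ((C : ℝ) ^ 3)
    rw [mul_zero] at h1
    refine squeeze_zero' (Eventually.of_forall fun _ => integral_nonneg fun _ => abs_nonneg _) ?_ h1
    filter_upwards [hb] with t ht
    exact ht.integral_abs_alphaRatio_sub_one_le hP
  have hαi : ∀ᶠ t in 𝓝[≠] (0 : ℝ),
      Integrable (fun o => alphaRatio δ P (path t) (covX o) - 1) (P : Measure (Obs 𝒳)) := by
    filter_upwards [hb] with t ht
    exact Integrable.of_bound (ham t).aestronglyMeasurable _ (ht.abs_alphaRatio_sub_one_le hP)
  have hαD : ∀ᶠ t in 𝓝[≠] (0 : ℝ), MemLp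
      (fun o => (alphaRatio δ P (path t) (covX o) - 1) * tiltResidual δ P T o) 2
      (P : Measure (Obs 𝒳)) := by
    filter_upwards [hb] with t ht
    refine hD.of_le_mul (c := (C : ℝ) ^ 2 + 1)
      ((ham t).mul (measurable_tiltResidual hT)).aestronglyMeasurable ?_
    filter_upwards [ht.abs_alphaRatio_sub_one_le hP] with o ho
    rw [norm_mul]
    gcongr
    exact ho
  have hrem2 : Tendsto (fun t => ∫ o, ((alphaRatio δ P (path t) (covX o) - 1) *
      tiltResidual δ P T o) ^ 2 ∂(P : Measure (Obs 𝒳))) (𝓝[≠] 0) (𝓝 0) := by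
    have h1 := (tendsto_integral_abs_mul_of_bounded (K := (C : ℝ) ^ 2 + 1) hD.integrable_sq hαi
      (hb.mono fun t ht => ht.abs_alphaRatio_sub_one_le hP) hα).const_mul ((C : ℝ) ^ 2 + 1)
    rw [mul_zero] at h1
    refine squeeze_zero' (Eventually.of_forall fun _ => integral_nonneg fun _ => sq_nonneg _) ?_ h1
    filter_upwards [hb] with t ht
    rw [← integral_const_mul]
    refine integral_mono_of_nonneg (Eventually.of_forall fun o => sq_nonneg _) ?_ ?_
    · refine Integrable.const_mul ?_ _
      refine hD.integrable_sq.abs.mul_bdd (c := (C : ℝ) ^ 2 + 1)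
        (ham t).norm.aestronglyMeasurable ?_
      filter_upwards [ht.abs_alphaRatio_sub_one_le hP] with o ho
      rwa [Real.norm_eq_abs, abs_abs]
    · filter_upwards [ht.abs_alphaRatio_sub_one_le hP] with o ho
      rw [mul_pow, abs_of_nonneg (sq_nonneg (tiltResidual δ P T o)),
        ← sq_abs (alphaRatio δ P (path t) (covX o) - 1)]
      have h2 := mul_le_mul_of_nonneg_right ho
        (mul_nonneg (abs_nonneg (alphaRatio δ P (path t) (covX o) - 1))
          (sq_nonneg (tiltResidual δ P T o)))
      linarith
  have hrem := h.hasL2Score.tendsto_integral_mul_zero hαD hrem2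
  have hmain := hasDerivAt_iff_tendsto_slope_zero.1 (h.hasDerivAt_integral hξ)
  rw [hasDerivAt_iff_tendsto_slope_zero]
  have hsum := hmain.add hrem
  rw [add_zero] at hsum
  refine hsum.congr' ?_
  filter_upwards [hb] with t ht
  rw [zero_add, h.at_zero, ht.tiltedMean_eq hP hT hint, ← hP.integral_xi hT hint]
  simp only [smul_eq_mul]
  have h3 : ∫ o, (likelihoodRatio P (path t) o - 1) / t *
      ((alphaRatio δ P (path t) (covX o) - 1) * tiltResidual δ P T o) ∂(P : Measure (Obs 𝒳)) =
      t⁻¹ * ∫ o, (likelihoodRatio P (path t) o - 1) *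
        ((alphaRatio δ P (path t) (covX o) - 1) * tiltResidual δ P T o)
          ∂(P : Measure (Obs 𝒳)) := by
    rw [← integral_const_mul]
    exact integral_congr_ae (Eventually.of_forall fun o => by ring)
  rw [h3]
  ring

/-- The difference between the tilted and the untilted mean of `T`, whose ratio for `Y` and `A`
is `ψ(δ)`. -/
def tiltContrast (δ : ℝ) (P : ProbabilityMeasure (Obs 𝒳)) (T : Obs 𝒳 → ℝ) : ℝ :=
  tiltedMean δ P T - ∫ o, T o ∂(P : Measure (Obs 𝒳))

theorem Theta_ae_eq (P : ProbabilityMeasure (Obs 𝒳)) (T : Obs 𝒳 → ℝ) :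
    ∀ᵐ o ∂(P : Measure (Obs 𝒳)), Theta δ P T o = xi δ P T o - T o := by
  filter_upwards [xi_zero_ae_eq P T] with o ho
  rw [Theta, ho]

theorem memLp_Theta (hT2 : MemLp T 2 (P : Measure (Obs 𝒳)))
    (hξ : MemLp (xi δ P T) 2 (P : Measure (Obs 𝒳))) :
    MemLp (Theta δ P T) 2 (P : Measure (Obs 𝒳)) :=
  (hξ.sub hT2).ae_eq ((Theta_ae_eq P T).mono fun _ ho => ho.symm)

theorem TiltFinite.integral_Theta (hP : TiltFinite δ P) (hT : Measurable T)
    (hint : Integrable (fun o => T o * tiltWeight δ P o) (P : Measure (Obs 𝒳)))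
    (hT2 : MemLp T 2 (P : Measure (Obs 𝒳)))
    (hξ : MemLp (xi δ P T) 2 (P : Measure (Obs 𝒳))) :
    ∫ o, Theta δ P T o ∂(P : Measure (Obs 𝒳)) = tiltContrast δ P T := by
  rw [integral_congr_ae (Theta_ae_eq P T), integral_sub (hξ.integrable one_le_two)
    (hT2.integrable one_le_two), hP.integral_xi hT hint, tiltContrast]

theorem IsDifferentiablePath.hasDerivAt_tiltContrast (h : IsDifferentiablePath C P path s)
    (hP : TiltFinite δ P) (hT : Measurable T)
    (hint : Integrable (fun o => T o * tiltWeight δ P o) (P : Measure (Obs 𝒳)))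
    (hT2 : MemLp T 2 (P : Measure (Obs 𝒳)))
    (hξ : MemLp (xi δ P T) 2 (P : Measure (Obs 𝒳))) :
    HasDerivAt (fun t => tiltContrast δ (path t) T)
      (∫ o, Theta δ P T o * s o ∂(P : Measure (Obs 𝒳))) 0 := by
  have hs := h.hasL2Score.score_memLp
  have h1 := (h.hasDerivAt_tiltedMean hP hT hint hξ).sub (h.hasDerivAt_integral hT2)
  rw [← integral_sub (f := fun o => xi δ P T o * s o) (g := fun o => T o * s o)
    (hξ.integrable_mul hs) (hT2.integrable_mul hs)] at h1
  rw [integral_congr_ae (g := fun o => xi δ P T o * s o - T o * s o)]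
  · exact h1
  · filter_upwards [Theta_ae_eq P T] with o ho
    rw [ho, sub_mul]

theorem memLp_expoA (P : ProbabilityMeasure (Obs 𝒳)) : MemLp expoA 2 (P : Measure (Obs 𝒳)) :=
  MemLp.of_bound measurable_expoA.aestronglyMeasurable 1
    (Eventually.of_forall fun o => abs_expoA_le_one o)

theorem TiltFinite.integrable_expoA_mul_tiltWeight (hP : TiltFinite δ P) :
    Integrable (fun o => expoA o * tiltWeight δ P o) (P : Measure (Obs 𝒳)) :=
  hP.integrable_tiltWeight.bdd_mul measurable_expoA.aestronglyMeasurable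
    (Eventually.of_forall fun o => abs_expoA_le_one o)

/-- The denominator of `φ_δ` is the denominator of `ψ(δ)`. -/
theorem TiltFinite.integral_gamma_sub_expoA (hP : TiltFinite δ P) :
    ∫ o, (gamma δ P expoA (covX o) - expoA o) ∂(P : Measure (Obs 𝒳)) =
      tiltContrast δ P expoA := by
  have hint := hP.integrable_expoA_mul_tiltWeight
  have h1 := integral_mul_gamma (P := P) (δ := δ) measurable_expoA (h := fun _ => 1)
    measurable_const (by simpa using hint)
  simp only [one_mul] at h1
  rw [integral_sub (integrable_gamma measurable_expoA hint)
    ((memLp_expoA P).integrable one_le_two), h1, tiltContrast,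
    tiltedMean_eq_integral measurable_expoA hint]

theorem memLp_phi (hY : MemLp outcomeY 2 (P : Measure (Obs 𝒳)))
    (hξY : MemLp (xi δ P outcomeY) 2 (P : Measure (Obs 𝒳)))
    (hξA : MemLp (xi δ P expoA) 2 (P : Measure (Obs 𝒳))) :
    MemLp (phi δ P) 2 (P : Measure (Obs 𝒳)) := by
  have h := ((memLp_Theta hY hξY).sub ((memLp_Theta (memLp_expoA P) hξA).const_mul
    (psi δ P))).const_mul (∫ o, (gamma δ P expoA (covX o) - expoA o) ∂(P : Measure (Obs 𝒳)))⁻¹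
  refine h.ae_eq (Eventually.of_forall fun o => ?_)
  simp only [phi, Pi.sub_apply, div_eq_inv_mul]

end TiltedDerivative

/-! ### The gradient of `ψ(δ)` -/

section EfficientInfluenceFunction

variable {𝒳 : Type*} [MeasurableSpace 𝒳] {δ : ℝ} {C : NNReal} {P : ProbabilityMeasure (Obs 𝒳)}
  {path : ℝ → ProbabilityMeasure (Obs 𝒳)} {s : Obs 𝒳 → ℝ}

theorem integral_phi (hP : InModel δ P) (hY : MemLp outcomeY 2 (P : Measure (Obs 𝒳)))
    (hξY : MemLp (xi δ P outcomeY) 2 (P : Measure (Obs 𝒳)))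
    (hξA : MemLp (xi δ P expoA) 2 (P : Measure (Obs 𝒳))) :
    ∫ o, phi δ P o ∂(P : Measure (Obs 𝒳)) = 0 := by
  have hfin : TiltFinite δ P := hP.tilt_finite
  have hA := memLp_expoA P
  have hne : tiltContrast δ P expoA ≠ 0 := sub_ne_zero.2 hP.relevance
  have h1 := hfin.integral_Theta measurable_outcomeY hP.integrable_tilted_outcome hY hξY
  have h2 := hfin.integral_Theta measurable_expoA hfin.integrable_expoA_mul_tiltWeight hA hξA
  have h3 : psi δ P = tiltContrast δ P outcomeY / tiltContrast δ P expoA := rfl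
  simp only [phi]
  rw [integral_div, integral_sub ((memLp_Theta hY hξY).integrable one_le_two)
    (((memLp_Theta hA hξA).integrable one_le_two).const_mul _), integral_const_mul, h1, h2, h3,
    div_mul_cancel₀ _ hne, sub_self, zero_div]

/-- The quotient rule for `ψ(δ)`, a ratio of two differentiable contrasts. -/
theorem IsDifferentiablePath.hasDerivAt_psi (h : IsDifferentiablePath C P path s)
    (hP : InModel δ P) (hY : MemLp outcomeY 2 (P : Measure (Obs 𝒳)))
    (hξY : MemLp (xi δ P outcomeY) 2 (P : Measure (Obs 𝒳)))
    (hξA : MemLp (xi δ P expoA) 2 (P : Measure (Obs 𝒳))) :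
    HasDerivAt (fun t => psi δ (path t)) (∫ o, phi δ P o * s o ∂(P : Measure (Obs 𝒳))) 0 := by
  have hfin : TiltFinite δ P := hP.tilt_finite
  have hA := memLp_expoA P
  have hs := h.hasL2Score.score_memLp
  have hne : tiltContrast δ P expoA ≠ 0 := sub_ne_zero.2 hP.relevance
  have h1 := h.hasDerivAt_tiltContrast hfin measurable_outcomeY hP.integrable_tilted_outcome hY hξY
  have h2 := h.hasDerivAt_tiltContrast hfin measurable_expoA
    hfin.integrable_expoA_mul_tiltWeight hA hξA
  have h3 : psi δ P = tiltContrast δ P outcomeY / tiltContrast δ P expoA := rfl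
  have h4 := h1.div h2 (by rwa [h.at_zero])
  have h5 : ∫ o, phi δ P o * s o ∂(P : Measure (Obs 𝒳)) =
      (∫ o, Theta δ P outcomeY o * s o ∂(P : Measure (Obs 𝒳)) -
        psi δ P * ∫ o, Theta δ P expoA o * s o ∂(P : Measure (Obs 𝒳))) /
          tiltContrast δ P expoA := by
    rw [← integral_const_mul, ← integral_sub (f := fun o => Theta δ P outcomeY o * s o)
      ((memLp_Theta hY hξY).integrable_mul hs)
      (g := fun o => psi δ P * (Theta δ P expoA o * s o))
      (((memLp_Theta hA hξA).integrable_mul hs).const_mul _), ← integral_div]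
    refine integral_congr_ae (Eventually.of_forall fun o => ?_)
    simp only [phi, hfin.integral_gamma_sub_expoA]
    ring
  rw [h.at_zero] at h4
  rw [h5, h3]
  refine h4.congr_deriv ?_
  field_simp

end EfficientInfluenceFunction

/-! ### Linear perturbations -/

section Perturbation

variable {Ω : Type*} [MeasurableSpace Ω] {P : ProbabilityMeasure Ω} {g : Ω → ℝ} {G : ℝ}

open Classical in
/-- The perturbed law `(1 + t g) dP`, where this is a probability measure, and `P` otherwise. -/
def perturbation (P : ProbabilityMeasure Ω) (g : Ω → ℝ) (t : ℝ) : ProbabilityMeasure Ω :=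
  if h : IsProbabilityMeasure
      ((P : Measure Ω).withDensity fun o => ENNReal.ofReal (1 + t * g o)) then
    ⟨(P : Measure Ω).withDensity fun o => ENNReal.ofReal (1 + t * g o), h⟩
  else P

theorem abs_mul_le_half {Ω : Type*} {g : Ω → ℝ} {G : ℝ} (hG : ∀ o, |g o| ≤ G) {t : ℝ} (ht : |t| * G ≤ 1 / 2) (o : Ω) :
    |t * g o| ≤ 1 / 2 := by
  rw [abs_mul]
  exact (mul_le_mul_of_nonneg_left (hG o) (abs_nonneg t)).trans ht

theorem coe_perturbation (hg : Measurable g) (hG : ∀ o, |g o| ≤ G)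
    (hmean : ∫ o, g o ∂(P : Measure Ω) = 0) {t : ℝ} (ht : |t| * G ≤ 1 / 2) :
    (perturbation P g t : Measure Ω) =
      (P : Measure Ω).withDensity fun o => ENNReal.ofReal (1 + t * g o) := by
  have hint : Integrable g (P : Measure Ω) :=
    Integrable.of_bound hg.aestronglyMeasurable G (Eventually.of_forall hG)
  have h : IsProbabilityMeasure
      ((P : Measure Ω).withDensity fun o => ENNReal.ofReal (1 + t * g o)) := by
    constructor
    rw [withDensity_apply _ MeasurableSet.univ, Measure.restrict_univ,
      ← ofReal_integral_eq_lintegral_ofReal (f := fun o => 1 + t * g o)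
        ((integrable_const 1).add (hint.const_mul t))
        (Eventually.of_forall fun o => ?_),
      integral_add (integrable_const 1) (hint.const_mul t), integral_const_mul, hmean]
    · simp
    · have := abs_le.1 (abs_mul_le_half hG ht o)
      simp only [Pi.zero_apply]
      linarith
  exact congrArg (fun μ : ProbabilityMeasure Ω => (μ : Measure Ω)) (dif_pos h)

theorem boundedRatio_perturbation (hg : Measurable g) (hG : ∀ o, |g o| ≤ G)
    (hmean : ∫ o, g o ∂(P : Measure Ω) = 0) {t : ℝ} (ht : |t| * G ≤ 1 / 2) :
    BoundedRatio 2 P (perturbation P g t) := by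
  have hf : Measurable fun o => ENNReal.ofReal (1 + t * g o) := by fun_prop
  constructor
  · rw [coe_perturbation hg hG hmean ht]
    refine (withDensity_mono (g := fun _ => (2 : ENNReal)) (Eventually.of_forall fun o => ?_)).trans
      (le_of_eq ?_)
    · have := abs_le.1 (abs_mul_le_half hG ht o)
      rw [← ENNReal.ofReal_ofNat]
      exact ENNReal.ofReal_le_ofReal (by linarith)
    · rw [withDensity_const]
      rfl
  · rw [coe_perturbation hg hG hmean ht]
    have h1 : (2 : NNReal) • (P : Measure Ω).withDensity (fun o => ENNReal.ofReal (1 + t * g o)) =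
        (P : Measure Ω).withDensity ((2 : ENNReal) • fun o => ENNReal.ofReal (1 + t * g o)) := by
      rw [withDensity_smul _ hf]
      rfl
    rw [h1]
    nth_rewrite 1 [← withDensity_one (μ := (P : Measure Ω))]
    refine withDensity_mono (Eventually.of_forall fun o => ?_)
    have := abs_le.1 (abs_mul_le_half hG ht o)
    simp only [Pi.one_apply, Pi.smul_apply, smul_eq_mul]
    rw [← ENNReal.ofReal_one, ← ENNReal.ofReal_ofNat, ← ENNReal.ofReal_mul (by norm_num)]
    exact ENNReal.ofReal_le_ofReal (by linarith)

theorem abs_sqrt_one_add_sub_le {u : ℝ} (hu : -1 ≤ u) : |√(1 + u) - 1 - u / 2| ≤ u ^ 2 / 2 := by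
  have h1 : √(1 + u) ^ 2 = 1 + u := Real.sq_sqrt (by linarith)
  have h2 := Real.sqrt_nonneg (1 + u)
  generalize √(1 + u) = v at *
  obtain rfl : u = v ^ 2 - 1 := by linarith
  have h3 : v - 1 - (v ^ 2 - 1) / 2 = -((v - 1) ^ 2 / 2) := by ring
  rw [h3, abs_neg, abs_of_nonneg (by positivity)]
  have h4 : (v ^ 2 - 1) ^ 2 = (v - 1) ^ 2 * (v + 1) ^ 2 := by ring
  have h5 : 1 ≤ (v + 1) ^ 2 := by nlinarith
  nlinarith [mul_le_mul_of_nonneg_left h5 (sq_nonneg (v - 1))]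

theorem eventually_abs_mul_le_half (G : ℝ) : ∀ᶠ t in 𝓝 (0 : ℝ), |t| * G ≤ 1 / 2 := by
  have h : Continuous fun t : ℝ => |t| * G := by fun_prop
  have h0 : |(0 : ℝ)| * G < 1 / 2 := by simp
  exact (h.continuousAt.eventually (gt_mem_nhds h0)).mono fun t ht => le_of_lt ht

theorem perturbation_zero (hg : Measurable g) (hG : ∀ o, |g o| ≤ G)
    (hmean : ∫ o, g o ∂(P : Measure Ω) = 0) : perturbation P g 0 = P := by
  refine Subtype.ext ?_
  have h := coe_perturbation (t := 0) hg hG hmean (by simp)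
  simp only [zero_mul, add_zero, ENNReal.ofReal_one] at h
  exact h.trans withDensity_one

theorem tendsto_eLpNorm_perturbation (hg : Measurable g) (hG : ∀ o, |g o| ≤ G)
    (hmean : ∫ o, g o ∂(P : Measure Ω) = 0) :
    Tendsto (fun t : ℝ => eLpNorm (fun o =>
      (√((perturbation P g t : Measure Ω).rnDeriv (P : Measure Ω) o).toReal - 1) / t - g o / 2) 2
        (P : Measure Ω)) (𝓝[≠] 0) (𝓝 0) := by
  have hlim : Tendsto (fun t : ℝ => ENNReal.ofReal (|t| * (G ^ 2 / 2))) (𝓝[≠] 0) (𝓝 0) := by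
    have h : Continuous fun t : ℝ => ENNReal.ofReal (|t| * (G ^ 2 / 2)) :=
      ENNReal.continuous_ofReal.comp (by fun_prop)
    simpa using (h.tendsto 0).mono_left nhdsWithin_le_nhds
  refine tendsto_of_tendsto_of_tendsto_of_le_of_le' tendsto_const_nhds hlim
    (Eventually.of_forall fun _ => zero_le) ?_
  filter_upwards [(eventually_abs_mul_le_half G).filter_mono nhdsWithin_le_nhds,
    self_mem_nhdsWithin] with t ht ht0
  have ht0 : t ≠ 0 := ht0
  have hf : Measurable fun o => ENNReal.ofReal (1 + t * g o) := by fun_prop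
  refine (eLpNorm_le_of_ae_bound (C := |t| * (G ^ 2 / 2)) ?_).trans (by simp)
  rw [coe_perturbation hg hG hmean ht]
  filter_upwards [Measure.rnDeriv_withDensity (P : Measure Ω) hf] with o ho
  have h1 := abs_le.1 (abs_mul_le_half hG ht o)
  rw [ho, ENNReal.toReal_ofReal (by linarith), Real.norm_eq_abs]
  have h2 : (√(1 + t * g o) - 1) / t - g o / 2 = (√(1 + t * g o) - 1 - t * g o / 2) / t := by
    field_simp
  have h3 : g o ^ 2 ≤ G ^ 2 := sq_le_sq' (by linarith [abs_le.1 (hG o)]) (abs_le.1 (hG o)).2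
  rw [h2, abs_div, div_le_iff₀ (abs_pos.2 ht0)]
  calc |√(1 + t * g o) - 1 - t * g o / 2| ≤ (t * g o) ^ 2 / 2 :=
        abs_sqrt_one_add_sub_le (by linarith)
    _ = t ^ 2 * (g o ^ 2 / 2) := by ring
    _ ≤ t ^ 2 * (G ^ 2 / 2) := by gcongr
    _ = |t| * (G ^ 2 / 2) * |t| := by rw [← sq_abs t]; ring

theorem memLp_of_abs_le (hg : Measurable g) (hG : ∀ o, |g o| ≤ G) :
    MemLp g 2 (P : Measure Ω) :=
  MemLp.of_bound hg.aestronglyMeasurable G (Eventually.of_forall hG)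

theorem isDifferentiablePath_perturbation (hg : Measurable g) (hG : ∀ o, |g o| ≤ G)
    (hmean : ∫ o, g o ∂(P : Measure Ω) = 0) :
    IsDifferentiablePath 2 P (perturbation P g) g :=
  isDifferentiablePath_of_quadratic_mean (perturbation_zero hg hG hmean)
    ((eventually_abs_mul_le_half G).mono fun _ ht => boundedRatio_perturbation hg hG hmean ht)
    (memLp_of_abs_le hg hG) (tendsto_eLpNorm_perturbation hg hG hmean)

end Perturbation

/-! ### The tangent space and uniqueness -/

section TangentSpace

variable {𝒳 : Type*} [MeasurableSpace 𝒳] {δ : ℝ} {P : ProbabilityMeasure (Obs 𝒳)}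

/-- Linear perturbations in bounded mean-zero directions stay in the model: the relevance condition
is open along the path, because the denominator of `ψ(δ)` is differentiable. -/
theorem isRegularSubmodel_perturbation (hP : InModel δ P)
    (hξA : MemLp (xi δ P expoA) 2 (P : Measure (Obs 𝒳))) {g : Obs 𝒳 → ℝ} {G : ℝ}
    (hg : Measurable g) (hG : ∀ o, |g o| ≤ G) (hmean : ∫ o, g o ∂(P : Measure (Obs 𝒳)) = 0) :
    IsRegularSubmodel (nonparametricModel 𝒳 δ) P (perturbation P g) g := by
  have hpath := isDifferentiablePath_perturbation hg hG hmean
  have hfin : TiltFinite δ P := hP.tilt_finite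
  refine ⟨hpath.at_zero, ?_, ⟨2, hpath.bounded.mono fun t ht => ⟨ht.le, ht.ge⟩⟩,
    memLp_of_abs_le hg hG, tendsto_eLpNorm_perturbation hg hG hmean⟩
  have hcont := (hpath.hasDerivAt_tiltContrast hfin measurable_expoA
    hfin.integrable_expoA_mul_tiltWeight (memLp_expoA P) hξA).continuousAt
  have hne : tiltContrast δ (perturbation P g 0) expoA ≠ 0 := by
    rw [hpath.at_zero]
    exact sub_ne_zero.2 hP.relevance
  filter_upwards [hpath.bounded, hcont.eventually_ne hne] with t ht htne
  exact ht.inModel hP (sub_ne_zero.1 htne)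

/-- Integration against `P` as a continuous functional on `L²(P)`: the inner product with `1`. -/
theorem integral_eq_inner_one {Ω : Type*} [MeasurableSpace Ω] (P : ProbabilityMeasure Ω)
    (g : Lp ℝ 2 (P : Measure Ω)) :
    ∫ o, g o ∂(P : Measure Ω) = inner ℝ ((memLp_const (1 : ℝ)).toLp (fun _ : Ω => (1 : ℝ))) g := by
  rw [L2.inner_def]
  refine integral_congr_ae ?_
  filter_upwards [(memLp_const (1 : ℝ) (μ := (P : Measure Ω)) (p := 2)).coeFn_toLp] with o ho
  rw [ho]
  simp

theorem integral_eq_zero_of_mem_tangentSpace {Ω : Type*} [MeasurableSpace Ω]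
    {M : Set (ProbabilityMeasure Ω)} {P : ProbabilityMeasure Ω} {g : Lp ℝ 2 (P : Measure Ω)}
    (hg : g ∈ tangentSpace M P) : ∫ o, g o ∂(P : Measure Ω) = 0 := by
  have hle : tangentSpace M P ≤
      (ℝ ∙ ((memLp_const (1 : ℝ) (μ := (P : Measure Ω)) (p := 2)).toLp fun _ => (1 : ℝ)))ᗮ := by
    refine Submodule.topologicalClosure_minimal _ (Submodule.span_le.2 ?_)
      (Submodule.isClosed_orthogonal _)
    rintro f ⟨path, hpath⟩
    obtain ⟨C, hC⟩ := hpath.exists_isDifferentiablePath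
    rw [SetLike.mem_coe, Submodule.mem_orthogonal_singleton_iff_inner_right,
      ← integral_eq_inner_one]
    exact hC.integral_score
  rw [integral_eq_inner_one]
  exact Submodule.mem_orthogonal_singleton_iff_inner_right.1 (hle hg)

/-- Centred indicators are scores, and centring is continuous on `L²(P)`, so every centred function
is a limit of finite sums of scores. -/
theorem mem_tangentSpace_of_integral_eq_zero (hP : InModel δ P)
    (hξA : MemLp (xi δ P expoA) 2 (P : Measure (Obs 𝒳))) (g : Lp ℝ 2 (P : Measure (Obs 𝒳)))
    (hg : ∫ o, g o ∂(P : Measure (Obs 𝒳)) = 0) :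
    g ∈ tangentSpace (nonparametricModel 𝒳 δ) P := by
  let one : Lp ℝ 2 (P : Measure (Obs 𝒳)) := (memLp_const (1 : ℝ)).toLp fun _ => (1 : ℝ)
  have hmem : ∀ f : Lp ℝ 2 (P : Measure (Obs 𝒳)),
      f - inner ℝ one f • one ∈ tangentSpace (nonparametricModel 𝒳 δ) P := by
    refine Lp.induction (by norm_num) _ ?_ ?_ ?_
    · intro c B hB hμB
      let k : Obs 𝒳 → ℝ := B.indicator fun _ => c
      let m : ℝ := ∫ o, k o ∂(P : Measure (Obs 𝒳))
      have hk : Measurable k := measurable_const.indicator hB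
      have hkc : ∀ o, |k o| ≤ |c| := fun o => by
        by_cases ho : o ∈ B <;> simp [k, ho]
      have hki : Integrable k (P : Measure (Obs 𝒳)) :=
        Integrable.of_bound hk.aestronglyMeasurable |c| (Eventually.of_forall hkc)
      have hsub := isRegularSubmodel_perturbation (g := fun o => k o - m) (G := |c| + |m|) hP hξA
        (hk.sub_const m) (fun o => (abs_sub _ _).trans (by simpa using hkc o)) (by
          rw [integral_sub hki (integrable_const m)]
          simp [m])
      refine Submodule.le_topologicalClosure _ (Submodule.subset_span ?_)
      refine ⟨perturbation P fun o => k o - m, ?_⟩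
      have hcoe : (Lp.simpleFunc.indicatorConst 2 hB hμB.ne c : Lp ℝ 2 (P : Measure (Obs 𝒳)))
          =ᵐ[(P : Measure (Obs 𝒳))] k := by
        rw [Lp.simpleFunc.coe_indicatorConst]
        exact indicatorConstLp_coeFn
      have hinner : inner ℝ one
          (Lp.simpleFunc.indicatorConst 2 hB hμB.ne c : Lp ℝ 2 (P : Measure (Obs 𝒳))) = m := by
        rw [← integral_eq_inner_one]
        exact integral_congr_ae hcoe
      rw [hinner]
      have hae : (fun o => k o - m) =ᵐ[(P : Measure (Obs 𝒳))]
          (((Lp.simpleFunc.indicatorConst 2 hB hμB.ne c : Lp ℝ 2 (P : Measure (Obs 𝒳))) - m • one :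
            Lp ℝ 2 (P : Measure (Obs 𝒳))) : Obs 𝒳 → ℝ) := by
        filter_upwards [hcoe, Lp.coeFn_sub
          (Lp.simpleFunc.indicatorConst 2 hB hμB.ne c : Lp ℝ 2 (P : Measure (Obs 𝒳))) (m • one),
          Lp.coeFn_smul m one,
          (memLp_const (1 : ℝ) (μ := (P : Measure (Obs 𝒳))) (p := 2)).coeFn_toLp]
          with o h1 h2 h3 h4
        rw [h2, Pi.sub_apply, h1, h3, Pi.smul_apply, h4]
        simp
      refine ⟨hsub.at_zero, hsub.mem_model, hsub.bounded_ratio, Lp.memLp _, ?_⟩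
      refine hsub.quadratic_mean.congr fun t => eLpNorm_congr_ae ?_
      filter_upwards [hae] with o ho
      rw [← ho]
    · intro f f' hf hf' _ h1 h2
      have := add_mem h1 h2
      rw [inner_add_right, add_smul]
      convert this using 1
      abel
    · have hc : Continuous fun f : Lp ℝ 2 (P : Measure (Obs 𝒳)) => f - inner ℝ one f • one := by
        fun_prop
      exact (Submodule.isClosed_topologicalClosure _).preimage hc
  have h := hmem g
  rwa [show inner ℝ one g = 0 by rw [← hg, integral_eq_inner_one], zero_smul, sub_zero] at h

/-- Two gradients have the same inner product with all scores, hence with the tangent space, to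
which their difference belongs. -/
theorem IsEfficientInfluenceFunction.ae_eq {Ω : Type*} [MeasurableSpace Ω]
    {M : Set (ProbabilityMeasure Ω)} {Ψ : ProbabilityMeasure Ω → ℝ} {P : ProbabilityMeasure Ω}
    {φ φ' : Ω → ℝ} (h : IsEfficientInfluenceFunction M Ψ P φ)
    (h' : IsEfficientInfluenceFunction M Ψ P φ') : φ' =ᵐ[(P : Measure Ω)] φ := by
  have hinner : ∀ {f : Ω → ℝ} (hf : MemLp f 2 (P : Measure Ω)) (g : Lp ℝ 2 (P : Measure Ω)),
      inner ℝ g (hf.toLp f) = ∫ o, f o * g o ∂(P : Measure Ω) := fun hf g => by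
    rw [L2.inner_def]
    refine integral_congr_ae ?_
    filter_upwards [hf.coeFn_toLp] with o ho
    rw [ho]
    rfl
  have horth : h'.memLp.toLp φ' - h.memLp.toLp φ ∈ (tangentSpace M P)ᗮ := by
    rw [tangentSpace, Submodule.orthogonal_closure]
    have hle : Submodule.span ℝ (tangentSet M P) ≤ (ℝ ∙ (h'.memLp.toLp φ' - h.memLp.toLp φ))ᗮ := by
      refine Submodule.span_le.2 ?_
      rintro g ⟨path, hpath⟩
      rw [SetLike.mem_coe, Submodule.mem_orthogonal_singleton_iff_inner_left, inner_sub_right,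
        hinner, hinner, (h'.hasDerivAt path g hpath).unique (h.hasDerivAt path g hpath), sub_self]
    exact fun g hg => Submodule.mem_orthogonal_singleton_iff_inner_left.1 (hle hg)
  have hzero := (Submodule.orthogonal_disjoint (tangentSpace M P)).le_bot
    ⟨sub_mem h'.mem_tangentSpace h.mem_tangentSpace, horth⟩
  exact (MemLp.toLp_eq_toLp_iff _ _).1 (sub_eq_zero.1 ((Submodule.mem_bot ℝ).1 hzero))

end TangentSpace

end TiltedLATE

end

theorem theorem1 {𝒳 : Type*} [MeasurableSpace 𝒳] (δ : ℝ)
    (P : ProbabilityMeasure (TiltedLATE.Obs 𝒳))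
    (hP : P ∈ TiltedLATE.nonparametricModel 𝒳 δ)
    (hY : MemLp TiltedLATE.outcomeY 2 (P : Measure (TiltedLATE.Obs 𝒳)))
    (hξY : MemLp (TiltedLATE.xi δ P TiltedLATE.outcomeY) 2 (P : Measure (TiltedLATE.Obs 𝒳)))
    (hξA : MemLp (TiltedLATE.xi δ P TiltedLATE.expoA) 2 (P : Measure (TiltedLATE.Obs 𝒳))) :
    -- `φ_δ` is an efficient influence function of `ψ(δ)` at `P` in the nonparametric model
    TiltedLATE.IsEfficientInfluenceFunction (TiltedLATE.nonparametricModel 𝒳 δ)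
        (TiltedLATE.psi δ) P (TiltedLATE.phi δ P) ∧
      -- it is the only one, up to almost sure equality
      (∀ φ' : TiltedLATE.Obs 𝒳 → ℝ,
        TiltedLATE.IsEfficientInfluenceFunction (TiltedLATE.nonparametricModel 𝒳 δ)
          (TiltedLATE.psi δ) P φ' →
        φ' =ᵐ[(P : Measure (TiltedLATE.Obs 𝒳))] TiltedLATE.phi δ P) ∧
      -- the tangent space consists of all mean-zero square-integrable functions
      (∀ g : Lp ℝ 2 (P : Measure (TiltedLATE.Obs 𝒳)),
        g ∈ TiltedLATE.tangentSpace (TiltedLATE.nonparametricModel 𝒳 δ) P ↔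
          ∫ o, g o ∂(P : Measure (TiltedLATE.Obs 𝒳)) = 0) := by
  have hphi := TiltedLATE.memLp_phi hY hξY hξA
  have hEIF : TiltedLATE.IsEfficientInfluenceFunction (TiltedLATE.nonparametricModel 𝒳 δ)
      (TiltedLATE.psi δ) P (TiltedLATE.phi δ P) := by
    refine ⟨hphi, ?_, fun path s hpath => ?_⟩
    · refine TiltedLATE.mem_tangentSpace_of_integral_eq_zero hP hξA _ ?_
      rw [integral_congr_ae hphi.coeFn_toLp]
      exact TiltedLATE.integral_phi hP hY hξY hξA
    · obtain ⟨C, hC⟩ := hpath.exists_isDifferentiablePath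
      exact hC.hasDerivAt_psi hP hY hξY hξA
  exact ⟨hEIF, fun φ' hφ' => hEIF.ae_eq hφ', fun g =>
    ⟨TiltedLATE.integral_eq_zero_of_mem_tangentSpace,
      TiltedLATE.mem_tangentSpace_of_integral_eq_zero hP hξA g⟩⟩
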